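/- Let $n\ge 3$, and let $g$ be a Riemannian metric of class $C^2$ on the sphere $S^n$ whose sectional curvatures are all positive. Let $R_{ij}$ denote its Ricci tensor, with the sign for which the round sphere has positive Ricci curvature. Then there is exactly one symmetric positive-definite twice-covariant tensor field $\chi$ on $S^n$ satisfying the once-contracted Gauss equation $$R_{ij} = (\operatorname{tr}\chi)\,\chi_{ij} - \chi_i{}^{k}\chi_{kj},$$ where the trace is taken, and the index raised, with respect to $g$ (that is, $\operatorname{tr}\chi=g^{ij}\chi_{ij}$ and $\chi_i{}^k=\chi_{il}g^{lk}$); uniqueness holds among all tensor fields, without any regularity assumption. Furthermore, if $g$ is of class $C^{k,\alpha}$ for some integer $k\ge 2$ and some $0\le\alpha<1$, then $\chi$ is of class $C^{k-2,\alpha}$. Here a tensor field is of class $C^{k,\alpha}$ if its components in each chart of the atlas of stereographic projections have continuous partial derivatives up to order $k$ and, when $\alpha>0$, those of order $k$ are locally Hölder continuous with exponent $\alpha$; in particular $C^{k,0}=C^k$. -/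

import Mathlib

open Metric Manifold Bundle Filter Topology Module
open scoped NNReal ContDiff

noncomputable section

namespace SphereGauss

/-- The coordinate space `ℝⁿ`. -/
abbrev Coord (n : ℕ) : Type := EuclideanSpace ℝ (Fin n)

/-- The unit sphere `Sⁿ ⊆ ℝⁿ⁺¹`, with Mathlib's manifold structure given by the atlas of
stereographic projections. -/
abbrev Sph (n : ℕ) : Type := sphere (0 : EuclideanSpace ℝ (Fin (n + 1))) 1

/-- The tangent space `T_p Sⁿ`. -/
abbrev Tan {n : ℕ} (p : Sph n) : Type := TangentSpace (𝓡 n) p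

/-- Twice-covariant tensor fields on `Sⁿ` (no regularity is imposed). -/
abbrev TensorField (n : ℕ) : Type := ∀ p : Sph n, Tan p →L[ℝ] Tan p →L[ℝ] ℝ

/-- Riemannian metrics on `Sⁿ` with two continuous derivatives. -/
abbrev C2Metric (n : ℕ) : Type :=
  ContMDiffRiemannianMetric (𝓡 n) 2 (Coord n) (fun p : Sph n => TangentSpace (𝓡 n) p)

/-! ### Curvature in local coordinates

In this section `G y` is the metric (a bilinear form on `ℝⁿ`) at the coordinate point `y`. -/

section Local

variable {n : ℕ}

/-- The Christoffel symbols of the first kind, as the covector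
`w ↦ ½ (∂_u G (v, w) + ∂_v G (u, w) - ∂_w G (u, v))`. -/
def christoffelLower (G : Coord n → Coord n →L[ℝ] Coord n →L[ℝ] ℝ) (y u v : Coord n) :
    Coord n →L[ℝ] ℝ :=
  (1 / 2 : ℝ) •
    (fderiv ℝ G y u v + fderiv ℝ G y v u - ((fderiv ℝ G y).flip u).flip v)

/-- The Christoffel symbols `Γ(u, v)`, with components `Γᵏᵢⱼ uⁱ vʲ`: the index of
`christoffelLower` is raised with the inverse of the metric. -/
def christoffel (G : Coord n → Coord n →L[ℝ] Coord n →L[ℝ] ℝ) (y u v : Coord n) : Coord n :=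
  (G y).inverse (christoffelLower G y u v)

/-- The Riemann curvature
`R(u, v) w = ∂_u Γ (v, w) - ∂_v Γ (u, w) + Γ(u, Γ(v, w)) - Γ(v, Γ(u, w))`, that is
`∇_u ∇_v w - ∇_v ∇_u w` for fields `u, v, w` with constant coefficients. -/
def riemann (G : Coord n → Coord n →L[ℝ] Coord n →L[ℝ] ℝ) (y u v w : Coord n) : Coord n :=
  fderiv ℝ (fun z => christoffel G z v w) y u - fderiv ℝ (fun z => christoffel G z u w) y v
    + christoffel G y u (christoffel G y v w) - christoffel G y v (christoffel G y u w)

/-- The Ricci curvature `Ric(v, w)`, the trace of `u ↦ R(u, v) w`. -/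
def ricciLocal (G : Coord n → Coord n →L[ℝ] Coord n →L[ℝ] ℝ) (y v w : Coord n) : ℝ :=
  ∑ i : Fin n, (riemann G y (EuclideanSpace.single i 1) v w) i

end Local

/-! ### Tensor fields on the sphere -/

section Global

variable {n : ℕ}

/-- The coordinate expression of the tensor field `T` in the chart around `p₀`: the pull-back of
`T` under the inverse of the chart, with components
`T_ij(y) = T (∂_i, ∂_j)` where `∂_i = d(chart⁻¹)_y e_i`. -/
def inChart (T : TensorField n) (p₀ : Sph n) (y : Coord n) : Coord n →L[ℝ] Coord n →L[ℝ] ℝ :=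
  let φ : Coord n → Sph n := (extChartAt (𝓡 n) p₀).symm
  let A : Coord n →L[ℝ] Coord n := mfderiv 𝓘(ℝ, Coord n) (𝓡 n) φ y
  let B : Coord n →L[ℝ] Coord n →L[ℝ] ℝ := T (φ y)
  B.bilinearComp A A

/-- At `p` itself the chart around `p` induces the identification of `T_p Sⁿ` with `ℝⁿ` that is
built into `TangentSpace`: there the coordinate expression of `T` is `T p`. -/
theorem inChart_self (T : TensorField n) (p : Sph n) (u v : Coord n) :
    inChart T p (extChartAt (𝓡 n) p p) u v = T p u v := by
  have h := mfderivWithin_range_extChartAt_symm (I := 𝓡 n) (x := p)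
  simp only [modelWithCornersSelf_coe, Set.range_id, mfderivWithin_univ] at h
  have key : ∀ (q : Sph n) (A : Coord n →L[ℝ] Coord n), q = p →
      A = ContinuousLinearMap.id ℝ (Coord n) →
      ((T q : Coord n →L[ℝ] Coord n →L[ℝ] ℝ).bilinearComp A A) u v = T p u v := by
    rintro q A rfl rfl
    rfl
  exact key _ _ (extChartAt_to_inv p) h

/-- `T` is of class `C^{k,α}`: in each chart the components of `T` have continuous derivatives up
to order `k`, and those of order `k` are locally Hölder continuous with exponent `α`.
For `α = 0` the last condition only says that they are locally bounded, so `C^{k,0} = C^k`. -/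
def IsHolderClass (k : ℕ) (α : ℝ≥0) (T : TensorField n) : Prop :=
  ∀ p₀ : Sph n,
    ContDiffOn ℝ k (inChart T p₀) (extChartAt (𝓡 n) p₀).target ∧
    ∀ y ∈ (extChartAt (𝓡 n) p₀).target, ∃ U ∈ 𝓝 y, ∃ C : ℝ≥0,
      HolderOnWith C α (iteratedFDeriv ℝ k (inChart T p₀)) U

/-- The Riemann curvature `R(u, v) w` of `g` at `p`. A tangent vector at `p` is, in Mathlib, the
vector of its coordinates in the preferred chart around `p`; accordingly the curvature is
evaluated in that chart. -/
def riemannAt (g : C2Metric n) (p : Sph n) (u v w : Tan p) : Tan p :=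
  riemann (inChart g.inner p) (extChartAt (𝓡 n) p p) u v w

/-- The sectional curvature of the plane spanned by `u` and `v`. -/
def sectionalCurvature (g : C2Metric n) (p : Sph n) (u v : Tan p) : ℝ :=
  g.inner p (riemannAt g p u v v) u /
    (g.inner p u u * g.inner p v v - g.inner p u v ^ 2)

/-- All sectional curvatures are positive. -/
def HasPositiveSectionalCurvature (g : C2Metric n) : Prop :=
  ∀ (p : Sph n) (u v : Tan p), LinearIndependent ℝ ![u, v] → 0 < sectionalCurvature g p u v

/-- The Ricci curvature of `g` at `p`, the trace of `u ↦ R(u, v) w`, evaluated in the preferred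
chart around `p`. -/
def ricci (g : C2Metric n) (p : Sph n) (v w : Tan p) : ℝ :=
  ricciLocal (inChart g.inner p) (extChartAt (𝓡 n) p p) v w

/-- The endomorphism `χ_i^k` of `T_p Sⁿ` obtained by raising an index of `χ` with the metric:
`g (shape u, v) = χ (u, v)`. -/
def shape (g : C2Metric n) (χ : TensorField n) (p : Sph n) : Tan p →L[ℝ] Tan p :=
  (g.inner p).inverse ∘L χ p

/-- The trace `tr χ = g^{ij} χ_ij` with respect to `g`. -/
def metricTrace (g : C2Metric n) (χ : TensorField n) (p : Sph n) : ℝ :=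
  LinearMap.trace ℝ (Tan p) (shape g χ p : Tan p →ₗ[ℝ] Tan p)

/-- `χ` is symmetric. -/
def IsSymm (χ : TensorField n) : Prop :=
  ∀ (p : Sph n) (u v : Tan p), χ p u v = χ p v u

/-- `χ` is positive definite. -/
def IsPosDef (χ : TensorField n) : Prop :=
  ∀ (p : Sph n) (u : Tan p), u ≠ 0 → 0 < χ p u u

/-- The once-contracted Gauss equation `R_ij = (tr χ) χ_ij - χ_i^k χ_kj`. -/
def OnceContractedGauss (g : C2Metric n) (χ : TensorField n) : Prop :=
  ∀ (p : Sph n) (u v : Tan p),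
    ricci g p u v = metricTrace g χ p * χ p u v - χ p (shape g χ p u) v

/-- `χ` is a symmetric positive-definite solution of the once-contracted Gauss equation. -/
def IsSolution (g : C2Metric n) (χ : TensorField n) : Prop :=
  IsSymm χ ∧ IsPosDef χ ∧ OnceContractedGauss g χ

end Global

end SphereGauss

end

/-! The full Gauss equation prescribes `λᵢ λⱼ` for every pair of principal directions and is
overdetermined. The contracted equation prescribes only `λᵢ ∑_{j ≠ i} λⱼ = ∑_{j ≠ i} Kᵢⱼ` in a basis
diagonalizing the Ricci form, where `Kᵢⱼ > 0` are the sectional curvatures of the coordinate planes.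
Writing `λᵢ = exp tᵢ`, this is the critical point equation of an energy in `t` that is coercive
because `K` is positive, whence a solution at every point. The right-hand side of the contracted
equation is a quadratic map `Q` of `χ`, so that `Q X - Q Y` is half the derivative of `Q` at
`X + Y` in the direction `X - Y`. In dimension at least three this derivative is injective at
positive definite forms. Uniqueness follows at once, and regularity follows from the implicit
function theorem, since the Ricci form has two derivatives fewer than the metric. -/

noncomputable section

set_option maxSynthPendingDepth 3

namespace SphereGauss

/-! ### Off-diagonal sums -/

section OffDiagonalSums

variable {ι : Type*} [Fintype ι]

theorem add_lt_sum_of_pos (h3 : 3 ≤ Fintype.card ι) {l : ι → ℝ} (hl : ∀ i, 0 < l i) {i j : ι}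
    (hij : i ≠ j) : l i + l j < ∑ k, l k := by
  classical
  obtain ⟨k, -, hk⟩ := Finset.exists_mem_notMem_of_card_lt_card (s := {i, j}) (t := Finset.univ)
    (by rw [Finset.card_pair hij, Finset.card_univ]; lia)
  rw [← Finset.sum_pair hij]
  exact Finset.sum_lt_sum_of_subset (Finset.subset_univ _) (Finset.mem_univ k) hk (hl k)
    fun a _ _ => (hl a).le

variable [DecidableEq ι]

theorem sum_compl_singleton_mul_add {A : ι → ι → ℝ} (hA : ∀ i j, A i j = A j i) (v : ι → ℝ) :
    ∑ i, ∑ j ∈ {i}ᶜ, A i j * (v i + v j) = 2 * ∑ i, v i * ∑ j ∈ {i}ᶜ, A i j := by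
  have hswap : ∑ i, ∑ j ∈ {i}ᶜ, A i j * v j = ∑ i, ∑ j ∈ {i}ᶜ, A i j * v i := by
    rw [Finset.sum_comm' (t' := Finset.univ) (s' := fun j => {j}ᶜ) (by simp [eq_comm])]
    simp only [hA]
  simp only [mul_add, Finset.sum_add_distrib, hswap, two_mul, mul_comm (v _), Finset.sum_mul]

theorem two_mul_abs_le_sum_abs_add (h3 : 3 ≤ Fintype.card ι) (t : ι → ℝ) (i : ι) :
    2 * |t i| ≤ ∑ a, ∑ b ∈ {a}ᶜ, |t a + t b| := by
  obtain ⟨j, hj, k, hk, hjk⟩ : ∃ j ∈ ({i}ᶜ : Finset ι), ∃ k ∈ ({i}ᶜ : Finset ι), j ≠ k := by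
    rw [← Finset.one_lt_card, Finset.card_compl, Finset.card_singleton]
    lia
  have hji : j ≠ i := by simpa using hj
  have htriangle : 2 * |t i| ≤ (|t i + t j| + |t i + t k|) + |t j + t k| := by
    rw [show 2 * |t i| = |(t i + t j) + (t i + t k) - (t j + t k)| by
      rw [← abs_two, ← abs_mul]; ring_nf]
    exact (abs_sub _ _).trans (by gcongr; exact abs_add_le _ _)
  have hrow_i : |t i + t j| + |t i + t k| ≤ ∑ b ∈ {i}ᶜ, |t i + t b| := by
    rw [← Finset.sum_pair (f := fun b => |t i + t b|) hjk]
    exact Finset.sum_le_sum_of_subset_of_nonneg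
      (Finset.insert_subset hj (Finset.singleton_subset_iff.2 hk))
      fun _ _ _ => abs_nonneg _
  have hrow_j : |t j + t k| ≤ ∑ b ∈ {j}ᶜ, |t j + t b| :=
    Finset.single_le_sum (f := fun b => |t j + t b|) (fun _ _ => abs_nonneg _)
      (by simpa using hjk.symm)
  calc 2 * |t i| ≤ ∑ b ∈ {i}ᶜ, |t i + t b| + ∑ b ∈ {j}ᶜ, |t j + t b| := by linarith
    _ = ∑ a ∈ {i, j}, ∑ b ∈ {a}ᶜ, |t a + t b| :=
      (Finset.sum_pair (f := fun a => ∑ b ∈ {a}ᶜ, |t a + t b|) hji.symm).symm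
    _ ≤ _ := Finset.sum_le_sum_of_subset_of_nonneg (Finset.subset_univ _)
      fun a _ _ => Finset.sum_nonneg fun b _ => abs_nonneg _

/-- Injectivity of the linearization at `l` of `l ↦ (lᵢ ∑_{j ≠ i} lⱼ)ᵢ`. -/
theorem eq_zero_of_mul_sum_add_mul_sum_eq_zero (h3 : 3 ≤ Fintype.card ι) {l x : ι → ℝ}
    (hl : ∀ i, 0 < l i) (hx : ∀ i, ∑ j ∈ {i}ᶜ, (l j * x i + l i * x j) = 0) : x = 0 := by
  let s : ι → ℝ := fun i => x i / l i
  have hxs : ∀ i, x i = l i * s i := fun i => (mul_div_cancel₀ _ (hl i).ne').symm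
  have hzero : ∑ i, ∑ j ∈ {i}ᶜ, l i * l j * (s i + s j) ^ 2 = 0 := by
    calc ∑ i, ∑ j ∈ {i}ᶜ, l i * l j * (s i + s j) ^ 2
        = ∑ i, ∑ j ∈ {i}ᶜ, l i * l j * (s i + s j) * (s i + s j) := by simp only [sq, mul_assoc]
      _ = 2 * ∑ i, s i * ∑ j ∈ {i}ᶜ, l i * l j * (s i + s j) :=
        sum_compl_singleton_mul_add (fun i j => by ring) s
      _ = 2 * ∑ i, s i * ∑ j ∈ {i}ᶜ, (l j * x i + l i * x j) := by
        congr! 4 with i _ j _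
        rw [hxs i, hxs j]
        ring
      _ = 0 := by simp only [hx, mul_zero, Finset.sum_const_zero]
  have hnonneg : ∀ i j, 0 ≤ l i * l j * (s i + s j) ^ 2 := fun i j => by
    have := hl i; have := hl j; positivity
  have hadd : ∀ i, ∀ j ∈ ({i}ᶜ : Finset ι), s i + s j = 0 := fun i j hj => by
    rw [Finset.sum_eq_zero_iff_of_nonneg fun i _ => Finset.sum_nonneg fun j _ => hnonneg i j]
      at hzero
    have := (Finset.sum_eq_zero_iff_of_nonneg fun j _ => hnonneg i j).1
      (hzero i (Finset.mem_univ i)) j hj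
    simpa [(hl i).ne', (hl j).ne'] using this
  have hs : ∀ i, s i = 0 := fun i => by
    have := two_mul_abs_le_sum_abs_add h3 s i
    rw [Finset.sum_eq_zero fun a _ => Finset.sum_eq_zero fun b hb => by rw [hadd a b hb, abs_zero]]
      at this
    exact abs_nonpos_iff.1 (by linarith)
  ext i
  simp [hxs, hs]

theorem exists_mul_abs_sub_le_exp_sub {c : ℝ} (hc : 0 < c) :
    ∃ B, ∀ s, c * |s| - B ≤ Real.exp s - c * s := by
  refine ⟨|2 * c * (1 - Real.log (2 * c))|, fun s => ?_⟩
  rcases le_total s 0 with hs | hs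
  · rw [abs_of_nonpos hs]
    linarith [Real.exp_pos s, abs_nonneg (2 * c * (1 - Real.log (2 * c)))]
  · have htangent : 2 * c * (s - Real.log (2 * c) + 1) ≤ Real.exp s :=
      calc 2 * c * (s - Real.log (2 * c) + 1) ≤ 2 * c * Real.exp (s - Real.log (2 * c)) := by
            gcongr; exact Real.add_one_le_exp _
        _ = Real.exp s := by
          rw [Real.exp_sub, Real.exp_log (by positivity), mul_div_cancel₀ _ (by positivity)]
    rw [abs_of_nonneg hs]
    linarith [neg_abs_le (2 * c * (1 - Real.log (2 * c)))]

/-- The functional of `t` whose critical points solve `∑_{j ≠ i} e ^ tᵢ * e ^ tⱼ = ∑_{j ≠ i} Kᵢⱼ`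
for all `i`. -/
def gaussEnergy (K : ι → ι → ℝ) (t : ι → ℝ) : ℝ :=
  ∑ i, ∑ j ∈ {i}ᶜ, (Real.exp (t i + t j) - K i j * (t i + t j))

theorem continuous_gaussEnergy (K : ι → ι → ℝ) : Continuous (gaussEnergy K) := by
  unfold gaussEnergy
  fun_prop

theorem exists_mul_norm_sub_le_gaussEnergy (h3 : 3 ≤ Fintype.card ι) {K : ι → ι → ℝ}
    (hK : ∀ i j, i ≠ j → 0 < K i j) : ∃ c > 0, ∃ B, ∀ t, c * ‖t‖ - B ≤ gaussEnergy K t := by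
  have hK' : ∀ i, ∀ j ∈ ({i}ᶜ : Finset ι), 0 < K i j := fun i j hj =>
    hK i j (by simpa [eq_comm] using hj)
  obtain ⟨c, hc, hcK⟩ : ∃ c > 0, ∀ i, ∀ j ∈ ({i}ᶜ : Finset ι), c ≤ K i j := by
    obtain ⟨i₀, j₀, h₀⟩ := Fintype.exists_pair_of_one_lt_card (show 1 < Fintype.card ι by lia)
    obtain ⟨p, hp, hmin⟩ := Finset.univ.offDiag.exists_min_image (fun p : ι × ι => K p.1 p.2)
      ⟨(i₀, j₀), by simpa using h₀⟩
    exact ⟨K p.1 p.2, hK _ _ (by simpa using hp), fun i j hj =>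
      hmin (i, j) (by simpa [eq_comm] using hj)⟩
  have hterm : ∀ i j, ∃ B, j ∈ ({i}ᶜ : Finset ι) →
      ∀ s, K i j * |s| - B ≤ Real.exp s - K i j * s := fun i j => by
    by_cases hj : j ∈ ({i}ᶜ : Finset ι)
    · exact (exists_mul_abs_sub_le_exp_sub (hK' i j hj)).imp fun _ h _ => h
    · exact ⟨0, fun h => absurd h hj⟩
  choose B hB using hterm
  refine ⟨2 * c, by positivity, ∑ i, ∑ j ∈ {i}ᶜ, B i j, fun t => ?_⟩
  have hnorm : 2 * ‖t‖ ≤ ∑ i, ∑ j ∈ {i}ᶜ, |t i + t j| := by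
    rw [← le_div_iff₀' two_pos]
    refine (pi_norm_le_iff_of_nonneg (by positivity)).2 fun i => ?_
    rw [le_div_iff₀' two_pos]
    exact two_mul_abs_le_sum_abs_add h3 t i
  calc 2 * c * ‖t‖ - ∑ i, ∑ j ∈ {i}ᶜ, B i j
      ≤ c * ∑ i, ∑ j ∈ {i}ᶜ, |t i + t j| - ∑ i, ∑ j ∈ {i}ᶜ, B i j := by nlinarith
    _ = ∑ i, ∑ j ∈ {i}ᶜ, (c * |t i + t j| - B i j) := by
      simp only [Finset.mul_sum, Finset.sum_sub_distrib]
    _ ≤ gaussEnergy K t := by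
      refine Finset.sum_le_sum fun i _ => Finset.sum_le_sum fun j hj => ?_
      exact (sub_le_sub_right (by gcongr; exact hcK i j hj) _).trans (hB i j hj _)

theorem exists_forall_gaussEnergy_le (h3 : 3 ≤ Fintype.card ι) {K : ι → ι → ℝ}
    (hK : ∀ i j, i ≠ j → 0 < K i j) : ∃ t, ∀ t', gaussEnergy K t ≤ gaussEnergy K t' := by
  obtain ⟨c, hc, B, hB⟩ := exists_mul_norm_sub_le_gaussEnergy h3 hK
  have hcoercive : Tendsto (gaussEnergy K) (cocompact (ι → ℝ)) atTop :=
    tendsto_atTop_mono hB (tendsto_atTop_add_const_right _ _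
      (tendsto_norm_cocompact_atTop.const_mul_atTop hc))
  exact (continuous_gaussEnergy K).exists_forall_le hcoercive

theorem hasDerivAt_gaussEnergy {K : ι → ι → ℝ} (hK : ∀ i j, K i j = K j i) (t : ι → ℝ) (i : ι) :
    HasDerivAt (fun ε : ℝ => gaussEnergy K (t + ε • Pi.single i 1))
      (2 * ∑ j ∈ {i}ᶜ, (Real.exp (t i + t j) - K i j)) 0 := by
  let v : ι → ℝ := Pi.single i 1
  have hterm : ∀ a b, HasDerivAt
      (fun ε : ℝ => Real.exp ((t + ε • v) a + (t + ε • v) b) -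
        K a b * ((t + ε • v) a + (t + ε • v) b))
      ((Real.exp (t a + t b) - K a b) * (v a + v b)) 0 := fun a b => by
    have hcoord : ∀ c, HasDerivAt (fun ε : ℝ => (t + ε • v) c) (v c) 0 := fun c => by
      simpa using ((hasDerivAt_id (0 : ℝ)).mul_const (v c)).const_add (t c)
    have hsum := (hcoord a).fun_add (hcoord b)
    refine (hsum.exp.fun_sub (hsum.const_mul (K a b))).congr_deriv ?_
    simp only [zero_smul, add_zero]
    ring
  have htotal := HasDerivAt.fun_sum (u := Finset.univ) fun a _ =>
    HasDerivAt.fun_sum (u := {a}ᶜ) fun b _ => hterm a b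
  rw [sum_compl_singleton_mul_add fun a b => by rw [hK, add_comm (t a)]] at htotal
  simpa [v, gaussEnergy, Pi.single_apply] using htotal

theorem exists_pos_mul_sum_eq_sum (h3 : 3 ≤ Fintype.card ι) {K : ι → ι → ℝ}
    (hsymm : ∀ i j, K i j = K j i) (hpos : ∀ i j, i ≠ j → 0 < K i j) :
    ∃ l : ι → ℝ, (∀ i, 0 < l i) ∧ ∀ i, l i * ∑ j ∈ {i}ᶜ, l j = ∑ j ∈ {i}ᶜ, K i j := by
  obtain ⟨t, ht⟩ := exists_forall_gaussEnergy_le h3 hpos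
  refine ⟨fun i => Real.exp (t i), fun i => Real.exp_pos _, fun i => ?_⟩
  have hmin : IsLocalMin (fun ε : ℝ => gaussEnergy K (t + ε • Pi.single i 1)) 0 :=
    Eventually.of_forall fun ε => by simpa using ht _
  have hcrit := hmin.hasDerivAt_eq_zero (hasDerivAt_gaussEnergy hsymm t i)
  rw [mul_eq_zero_iff_left two_ne_zero, Finset.sum_sub_distrib, sub_eq_zero] at hcrit
  simpa only [Finset.mul_sum, ← Real.exp_add] using hcrit

end OffDiagonalSums

/-! ### The quadratic map of the once-contracted Gauss equation -/

section InnerProducts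

theorem exists_basis_eigenvectors {V : Type*} [AddCommGroup V] [Module ℝ V]
    [FiniteDimensional ℝ V] (G : V →ₗ[ℝ] V →ₗ[ℝ] ℝ) (hsymm : ∀ u v, G u v = G v u)
    (hpos : ∀ u, u ≠ 0 → 0 < G u u) (T : V →ₗ[ℝ] V) (hT : ∀ u v, G (T u) v = G u (T v)) :
    ∃ (b : Basis (Fin (finrank ℝ V)) ℝ V) (l : Fin (finrank ℝ V) → ℝ),
      (∀ i j, G (b i) (b j) = if i = j then 1 else 0) ∧ ∀ i, T (b i) = l i • b i := by
  let core : InnerProductSpace.Core ℝ V :=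
    { inner := fun u v => G u v
      conj_inner_symm := fun u v => by simpa using hsymm v u
      re_inner_nonneg := fun u => by
        by_cases hu : u = 0
        · simp [hu]
        · simpa using (hpos u hu).le
      add_left := fun u v w => by simp
      smul_left := fun u v r => by simp
      definite := fun u hu => by
        by_contra h
        exact (hpos u h).ne' hu }
  let _ : NormedAddCommGroup V := core.toNormedAddCommGroup
  let _ : InnerProductSpace ℝ V := InnerProductSpace.ofCore core.toCore
  have hTsymm : T.IsSymmetric := hT
  refine ⟨(hTsymm.eigenvectorBasis rfl).toBasis, hTsymm.eigenvalues rfl, fun i j => ?_, fun i => ?_⟩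
  · rw [OrthonormalBasis.coe_toBasis]
    exact orthonormal_iff_ite.1 (hTsymm.eigenvectorBasis rfl).orthonormal i j
  · simp

variable {E F : Type*} [NormedAddCommGroup E] [NormedSpace ℝ E]
  [NormedAddCommGroup F] [NormedSpace ℝ F]

/-- Symmetric positive-definite bilinear forms: the values of a Riemannian metric. -/
structure IsInnerProduct (G : E →L[ℝ] E →L[ℝ] ℝ) : Prop where
  symm : ∀ u v, G u v = G v u
  pos : ∀ u, u ≠ 0 → 0 < G u u

/-- Orthonormality of a family of vectors with respect to a bilinear form that need not be the
inner product of the ambient space. -/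
def IsOrthonormal {ι : Type*} [DecidableEq ι] (G : E →L[ℝ] E →L[ℝ] ℝ) (b : ι → E) : Prop :=
  ∀ i j, G (b i) (b j) = if i = j then 1 else 0

theorem bilin_ext {ι : Type*} {X Y : E →L[ℝ] E →L[ℝ] ℝ} (b : Basis ι ℝ E)
    (h : ∀ i j, X (b i) (b j) = Y (b i) (b j)) : X = Y :=
  ContinuousLinearMap.coe_injective (b.ext fun i => ContinuousLinearMap.coe_injective (b.ext (h i)))

theorem IsInnerProduct.add {G H : E →L[ℝ] E →L[ℝ] ℝ} (hG : IsInnerProduct G)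
    (hH : IsInnerProduct H) : IsInnerProduct (G + H) :=
  ⟨fun u v => congr($(hG.symm u v) + $(hH.symm u v)),
    fun u hu => add_pos (hG.pos u hu) (hH.pos u hu)⟩

theorem IsInnerProduct.sq_apply_le {G : E →L[ℝ] E →L[ℝ] ℝ} (hG : IsInnerProduct G) (u v : E) :
    G u v ^ 2 ≤ G u u * G v v := by
  have hnonneg (w : E) : 0 ≤ G w w := by
    obtain rfl | hw := eq_or_ne w 0
    · rw [map_zero]
    · exact (hG.pos w hw).le
  exact G.toBilinForm.apply_sq_le_of_symm hnonneg ⟨hG.symm⟩ u v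

/-- The bilinear form with matrix `diag l` in the `G`-orthonormal family `b`. -/
def diagForm {ι : Type*} [Fintype ι] (G : E →L[ℝ] E →L[ℝ] ℝ) (b : ι → E) (l : ι → ℝ) :
    E →L[ℝ] E →L[ℝ] ℝ :=
  ∑ i, l i • (G (b i)).smulRight (G (b i))

theorem diagForm_apply {ι : Type*} [Fintype ι] (G : E →L[ℝ] E →L[ℝ] ℝ) (b : ι → E) (l : ι → ℝ)
    (u v : E) : diagForm G b l u v = ∑ i, l i * (G (b i) u * G (b i) v) := by
  simp [diagForm]

section Basis

variable {ι : Type*} [DecidableEq ι] {G : E →L[ℝ] E →L[ℝ] ℝ} {b : Basis ι ℝ E} {l : ι → ℝ}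

theorem IsOrthonormal.repr_apply (hb : IsOrthonormal G b) (v : E) (i : ι) :
    b.repr v i = G v (b i) := by
  have hcoord : b.coord i = G.flip (b i) :=
    b.ext fun j => by simp [hb j i, Finsupp.single_apply]
  exact congr($hcoord v)

variable [Fintype ι]

theorem IsOrthonormal.trace_eq_sum (hb : IsOrthonormal G b) (T : E →ₗ[ℝ] E) :
    LinearMap.trace ℝ E T = ∑ i, G (T (b i)) (b i) := by
  simp only [LinearMap.trace_eq_matrix_trace ℝ b, Matrix.trace, Matrix.diag_apply,
    LinearMap.toMatrix_apply, hb.repr_apply]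

theorem IsOrthonormal.diagForm_apply_basis {b : ι → E} (hb : IsOrthonormal G b) (l : ι → ℝ)
    (i : ι) : diagForm G b l (b i) = l i • G (b i) := by
  ext v
  simp [diagForm_apply, hb _ i]

theorem isInnerProduct_diagForm (hG : IsInnerProduct G) (hb : IsOrthonormal G b)
    (hl : ∀ i, 0 < l i) : IsInnerProduct (diagForm G b l) := by
  refine ⟨fun u v => by simp only [diagForm_apply, mul_comm], fun u hu => ?_⟩
  obtain ⟨i, hi⟩ : ∃ i, G (b i) u ≠ 0 := by
    by_contra! h0
    refine hu (b.repr.map_eq_zero_iff.1 (Finsupp.ext fun i => ?_))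
    rw [hb.repr_apply, hG.symm, h0, Finsupp.zero_apply]
  rw [diagForm_apply]
  exact Finset.sum_pos' (fun j _ => mul_nonneg (hl j).le (mul_self_nonneg _))
    ⟨i, Finset.mem_univ i, mul_pos (hl i) (mul_self_pos.2 hi)⟩

end Basis

variable [FiniteDimensional ℝ E] [FiniteDimensional ℝ F]

theorem isInvertible_of_injective (hdim : finrank ℝ E = finrank ℝ F) {L : E →L[ℝ] F}
    (hL : ∀ u, L u = 0 → u = 0) : L.IsInvertible :=
  ⟨(LinearEquiv.ofInjectiveOfFinrankEq (L : E →ₗ[ℝ] F)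
    ((injective_iff_map_eq_zero L).2 hL) hdim).toContinuousLinearEquiv, rfl⟩

theorem finrank_dual_eq : finrank ℝ (E →L[ℝ] ℝ) = finrank ℝ E :=
  (LinearMap.toContinuousLinearMap (𝕜 := ℝ) (E := E) (F' := ℝ)).finrank_eq.symm.trans
    Subspace.dual_finrank_eq

namespace IsInnerProduct

variable {G M : E →L[ℝ] E →L[ℝ] ℝ}

theorem isInvertible (hG : IsInnerProduct G) : G.IsInvertible := by
  refine isInvertible_of_injective finrank_dual_eq.symm fun u hu => ?_
  by_contra hne
  exact (hG.pos u hne).ne' (by rw [hu, zero_apply])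

theorem apply_inverse (hG : IsInnerProduct G) (f : E →L[ℝ] ℝ) : G (G.inverse f) = f :=
  hG.isInvertible.self_apply_inverse f

theorem exists_orthonormal_diagonalizing (hG : IsInnerProduct G) (hM : ∀ u v, M u v = M v u) :
    ∃ (b : Basis (Fin (finrank ℝ E)) ℝ E) (l : Fin (finrank ℝ E) → ℝ),
      IsOrthonormal G b ∧ ∀ i, M (b i) = l i • G (b i) := by
  obtain ⟨b, l, hb, hl⟩ := exists_basis_eigenvectors G.toLinearMap₁₂ hG.symm hG.pos
    (G.inverse ∘L M : E →L[ℝ] E) fun u v => by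
      change G (G.inverse (M u)) v = G u (G.inverse (M v))
      rw [hG.apply_inverse, hG.symm, hG.apply_inverse, hM]
  refine ⟨b, l, hb, fun i => ?_⟩
  rw [← map_smul, ← hG.isInvertible.inverse_apply_eq]
  exact hl i

theorem exists_orthonormal_basis (hG : IsInnerProduct G) :
    ∃ b : Basis (Fin (finrank ℝ E)) ℝ E, IsOrthonormal G b :=
  let ⟨b, _, hb, _⟩ := hG.exists_orthonormal_diagonalizing hG.symm
  ⟨b, hb⟩

theorem trace_inverse_comp {ι : Type*} [Fintype ι] [DecidableEq ι] {b : Basis ι ℝ E}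
    (hG : IsInnerProduct G) (hb : IsOrthonormal G b) (X : E →L[ℝ] E →L[ℝ] ℝ) :
    LinearMap.trace ℝ E (G.inverse ∘L X : E →L[ℝ] E) = ∑ i, X (b i) (b i) := by
  simp [hb.trace_eq_sum, hG.apply_inverse]

theorem eventually_pos (hG : IsInnerProduct G) : ∀ᶠ B in 𝓝 G, ∀ u : E, u ≠ 0 → 0 < B u u := by
  have hsphere : ∀ᶠ B in 𝓝 G, ∀ u ∈ sphere (0 : E) 1, 0 < B u u := by
    have := FiniteDimensional.proper ℝ E
    refine (isCompact_sphere (0 : E) 1).eventually_forall_of_forall_eventually fun u hu => ?_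
    have hcont : Continuous fun p : (E →L[ℝ] E →L[ℝ] ℝ) × E => p.1 p.2 p.2 := by fun_prop
    exact hcont.continuousAt.eventually_const_lt (hG.pos u (ne_of_mem_sphere hu one_ne_zero))
  filter_upwards [hsphere] with B hB u hu
  have hunit := hB (‖u‖⁻¹ • u) (by
    rw [mem_sphere_zero_iff_norm, norm_smul, norm_inv, norm_norm,
      inv_mul_cancel₀ (norm_ne_zero_iff.2 hu)])
  simp only [map_smul, smul_apply, smul_eq_mul, ← mul_assoc] at hunit
  exact pos_of_mul_pos_right hunit (mul_self_nonneg _)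

end IsInnerProduct

end InnerProducts

section GaussMap

variable {E : Type*} [NormedAddCommGroup E] [NormedSpace ℝ E]

/-- The right-hand side `(tr X) X_ij - X_i^k X_kj` of the contracted Gauss equation, with trace
and raised index taken with respect to `G`. -/
def gaussMap (G X : E →L[ℝ] E →L[ℝ] ℝ) : E →L[ℝ] E →L[ℝ] ℝ :=
  LinearMap.trace ℝ E (G.inverse ∘L X : E →L[ℝ] E) • X - X ∘L G.inverse ∘L X

/-- The derivative of the quadratic map `gaussMap G` at `M` in direction `X`. -/
def gaussLin (G M X : E →L[ℝ] E →L[ℝ] ℝ) : E →L[ℝ] E →L[ℝ] ℝ :=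
  LinearMap.trace ℝ E (G.inverse ∘L X : E →L[ℝ] E) • M +
    LinearMap.trace ℝ E (G.inverse ∘L M : E →L[ℝ] E) • X -
    M ∘L G.inverse ∘L X - X ∘L G.inverse ∘L M

theorem gaussLin_add_sub (G X Y : E →L[ℝ] E →L[ℝ] ℝ) :
    gaussLin G (X + Y) (X - Y) = (2 : ℝ) • (gaussMap G X - gaussMap G Y) := by
  simp only [gaussLin, gaussMap, ContinuousLinearMap.comp_add, ContinuousLinearMap.comp_sub,
    ContinuousLinearMap.toLinearMap_add, ContinuousLinearMap.toLinearMap_sub, map_add, map_sub,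
    ContinuousLinearMap.add_comp, ContinuousLinearMap.sub_comp]
  module

theorem gaussMap_add_smul (G X Y : E →L[ℝ] E →L[ℝ] ℝ) (t : ℝ) :
    gaussMap G (X + t • Y) = gaussMap G X + t • gaussLin G X Y + t ^ 2 • gaussMap G Y := by
  simp only [gaussLin, gaussMap, ContinuousLinearMap.comp_add, ContinuousLinearMap.comp_smul,
    ContinuousLinearMap.toLinearMap_add, ContinuousLinearMap.toLinearMap_smul, map_add, map_smul,
    ContinuousLinearMap.add_comp, ContinuousLinearMap.smul_comp]
  module

theorem hasLineDerivAt_gaussMap (G X Y : E →L[ℝ] E →L[ℝ] ℝ) :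
    HasLineDerivAt ℝ (gaussMap G) (gaussLin G X Y) X Y := by
  simp only [HasLineDerivAt, gaussMap_add_smul]
  have hlinear : HasDerivAt (fun t : ℝ => t • gaussLin G X Y) (gaussLin G X Y) 0 := by
    simpa using (hasDerivAt_id (0 : ℝ)).smul_const (gaussLin G X Y)
  have hquadratic : HasDerivAt (fun t : ℝ => t ^ 2 • gaussMap G Y) 0 0 := by
    simpa using (hasDerivAt_pow 2 (0 : ℝ)).smul_const (gaussMap G Y)
  simpa using (hlinear.const_add (gaussMap G X)).fun_add hquadratic

variable [FiniteDimensional ℝ E] {G M X Y : E →L[ℝ] E →L[ℝ] ℝ}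

theorem gaussMap_flip (hG : IsInnerProduct G) (X : E →L[ℝ] E →L[ℝ] ℝ) :
    gaussMap G X.flip = (gaussMap G X).flip := by
  obtain ⟨b, hb⟩ := hG.exists_orthonormal_basis
  have hcomp : ∀ u v, X v (G.inverse (X.flip u)) = X (G.inverse (X v)) u := fun u v =>
    calc X v (G.inverse (X.flip u)) = G (G.inverse (X v)) (G.inverse (X.flip u)) := by
          rw [hG.apply_inverse]
      _ = X.flip u (G.inverse (X v)) := by rw [hG.symm, hG.apply_inverse]
  ext u v
  simp only [gaussMap, hG.trace_inverse_comp hb, sub_apply, smul_apply,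
    ContinuousLinearMap.comp_apply, ContinuousLinearMap.flip_apply, hcomp]

theorem gaussMap_bilinearComp (hG : IsInnerProduct G) (X : E →L[ℝ] E →L[ℝ] ℝ) {A : E →L[ℝ] E}
    (hA : A.IsInvertible) (hG' : IsInnerProduct (G.bilinearComp A A)) :
    gaussMap (G.bilinearComp A A) (X.bilinearComp A A) = (gaussMap G X).bilinearComp A A := by
  have hshape : (G.bilinearComp A A).inverse ∘L X.bilinearComp A A =
      A.inverse ∘L ((G.inverse ∘L X) ∘L A) := by
    ext w : 1
    refine hG'.isInvertible.inverse_apply_eq.2 ?_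
    ext z
    change X (A w) (A z) = G (A (A.inverse (G.inverse (X (A w))))) (A z)
    rw [hA.self_apply_inverse, hG.apply_inverse]
  have htrace : LinearMap.trace ℝ E (A.inverse ∘L ((G.inverse ∘L X) ∘L A) : E →L[ℝ] E) =
      LinearMap.trace ℝ E (G.inverse ∘L X : E →L[ℝ] E) := by
    refine (LinearMap.trace_comp_comm' (R := ℝ)
      (((G.inverse ∘L X) ∘L A : E →L[ℝ] E) : E →ₗ[ℝ] E) (A.inverse : E →ₗ[ℝ] E)).trans ?_
    congr 1
    ext w
    exact congr(G.inverse (X $(hA.self_apply_inverse w)))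
  ext u v
  simp only [gaussMap, hshape, htrace]
  change _ * X (A u) (A v) - X (A (A.inverse (G.inverse (X (A u))))) (A v) = _
  rw [hA.self_apply_inverse]
  rfl

section Components

variable {ι : Type*} [Fintype ι] [DecidableEq ι] {b : Basis ι ℝ E} {l : ι → ℝ}

theorem IsInnerProduct.inverse_apply_of_eq_smul (hG : IsInnerProduct G) {c : ℝ} {u : E}
    (hM : M u = c • G u) : G.inverse (M u) = c • u :=
  hG.isInvertible.inverse_apply_eq.2 (by rw [hM, map_smul])

theorem gaussMap_apply_basis (hG : IsInnerProduct G) (hb : IsOrthonormal G b)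
    (hX : ∀ i, X (b i) = l i • G (b i)) (i j : ι) :
    gaussMap G X (b i) (b j) = if i = j then l i * ∑ k ∈ {i}ᶜ, l k else 0 := by
  have hXb : ∀ i j, X (b i) (b j) = l i * if i = j then 1 else 0 := fun i j => by
    rw [hX, smul_apply, hb, smul_eq_mul]
  simp only [gaussMap, sub_apply, smul_apply, ContinuousLinearMap.comp_apply, smul_eq_mul,
    map_smul, hG.trace_inverse_comp hb, hG.inverse_apply_of_eq_smul (hX i), hXb, if_true, mul_one]
  rw [Fintype.sum_eq_add_sum_compl i]
  split_ifs <;> ring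

theorem gaussLin_apply_basis (hG : IsInnerProduct G) (hb : IsOrthonormal G b)
    (hM : IsInnerProduct M) (hl : ∀ i, M (b i) = l i • G (b i)) (i j : ι) :
    gaussLin G M X (b i) (b j) = (∑ k, X (b k) (b k)) * (if i = j then l i else 0) +
      ((∑ k, l k) - l i - l j) * X (b i) (b j) := by
  have hMX : M (G.inverse (X (b i))) (b j) = l j * X (b i) (b j) := by
    rw [hM.symm, hl, smul_apply, hG.symm, hG.apply_inverse, smul_eq_mul]
  have hMb : ∀ i j, M (b i) (b j) = if i = j then l i else 0 := fun i j => by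
    rw [hl, smul_apply, hb, smul_eq_mul, mul_ite, mul_one, mul_zero]
  simp only [gaussLin, sub_apply, add_apply, smul_apply, ContinuousLinearMap.comp_apply, hMX,
    hG.trace_inverse_comp hb, hG.inverse_apply_of_eq_smul (hl i), map_smul, smul_eq_mul, hMb,
    if_true]
  ring

theorem exists_isInnerProduct_gaussMap_apply_basis (h3 : 3 ≤ Fintype.card ι)
    (hG : IsInnerProduct G) (hb : IsOrthonormal G b) {K : ι → ι → ℝ}
    (hsymm : ∀ i j, K i j = K j i) (hpos : ∀ i j, i ≠ j → 0 < K i j) :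
    ∃ X, IsInnerProduct X ∧
      ∀ i j, gaussMap G X (b i) (b j) = if i = j then ∑ k ∈ {i}ᶜ, K i k else 0 := by
  obtain ⟨l, hl, hlK⟩ := exists_pos_mul_sum_eq_sum h3 hsymm hpos
  refine ⟨diagForm G b l, isInnerProduct_diagForm hG hb hl, fun i j => ?_⟩
  rw [gaussMap_apply_basis hG hb (hb.diagForm_apply_basis l), hlK]

end Components

theorem eq_zero_of_gaussLin_eq_zero (h3 : 3 ≤ finrank ℝ E) (hG : IsInnerProduct G)
    (hM : IsInnerProduct M) (h : gaussLin G M X = 0) : X = 0 := by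
  obtain ⟨b, l, hb, hl⟩ := hG.exists_orthonormal_diagonalizing hM.symm
  have hcard : 3 ≤ Fintype.card (Fin (finrank ℝ E)) := by rwa [Fintype.card_fin]
  have hlpos : ∀ i, 0 < l i := fun i => by
    have := hM.pos (b i) (b.ne_zero i)
    rwa [hl, smul_apply, hb, if_pos rfl, smul_eq_mul, mul_one] at this
  have hcomp : ∀ i j, (∑ k, X (b k) (b k)) * (if i = j then l i else 0) +
      ((∑ k, l k) - l i - l j) * X (b i) (b j) = 0 := fun i j => by
    rw [← gaussLin_apply_basis hG hb hM hl, h, zero_apply, zero_apply]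
  have hdiag : (fun i => X (b i) (b i)) = 0 := by
    refine eq_zero_of_mul_sum_add_mul_sum_eq_zero hcard hlpos fun i => ?_
    rw [← hcomp i i, if_pos rfl, Fintype.sum_eq_add_sum_compl i l,
      Fintype.sum_eq_add_sum_compl i fun k => X (b k) (b k), Finset.sum_add_distrib,
      ← Finset.sum_mul, ← Finset.mul_sum]
    ring
  refine bilin_ext b fun i j => ?_
  rw [zero_apply, zero_apply]
  by_cases hij : i = j
  · exact hij ▸ congrFun hdiag i
  · have hoff := hcomp i j
    rw [if_neg hij, mul_zero, zero_add] at hoff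
    exact (mul_eq_zero.1 hoff).resolve_left (by linarith [add_lt_sum_of_pos hcard hlpos hij])

theorem eq_of_gaussMap_eq (h3 : 3 ≤ finrank ℝ E) (hG : IsInnerProduct G)
    (hXY : IsInnerProduct (X + Y)) (h : gaussMap G X = gaussMap G Y) : X = Y := by
  refine sub_eq_zero.1 (eq_zero_of_gaussLin_eq_zero h3 hG hXY ?_)
  rw [gaussLin_add_sub, h, sub_self, smul_zero]

theorem isInnerProduct_of_gaussMap_symm (h3 : 3 ≤ finrank ℝ E) (hG : IsInnerProduct G)
    (hpos : ∀ u, u ≠ 0 → 0 < X u u) (hsymm : ∀ u v, gaussMap G X u v = gaussMap G X v u) :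
    IsInnerProduct X := by
  have hflip : X.flip = X := by
    refine eq_of_gaussMap_eq h3 hG ⟨fun u v => add_comm _ _,
      fun u hu => add_pos (hpos u hu) (hpos u hu)⟩ ?_
    rw [gaussMap_flip hG]
    ext u v
    exact hsymm v u
  exact ⟨fun u v => congr($hflip v u), hpos⟩

end GaussMap

/-! ### Hölder classes -/

section Holder

variable {E F F' : Type*} [NormedAddCommGroup E] [NormedSpace ℝ E] [NormedAddCommGroup F]
  [NormedSpace ℝ F] [NormedAddCommGroup F'] [NormedSpace ℝ F'] {k : ℕ} {α : ℝ≥0} {x : E}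
  {f : E → F}

/-- `f` is of class `C^{k,α}` near `x`. For `α = 0` the Hölder condition only says that the
derivatives of order `k` are bounded near `x`. -/
def HolderAt (k : ℕ) (α : ℝ≥0) (f : E → F) (x : E) : Prop :=
  ContDiffAt ℝ k f x ∧ ∃ U ∈ 𝓝 x, ∃ C : ℝ≥0, HolderOnWith C α (iteratedFDeriv ℝ k f) U

theorem HolderAt.congr_of_eventuallyEq {g : E → F} (hf : HolderAt k α f x) (h : g =ᶠ[𝓝 x] f) :
    HolderAt k α g x := by
  obtain ⟨hdiff, U, hU, C, hC⟩ := hf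
  refine ⟨hdiff.congr_of_eventuallyEq h, _, inter_mem hU (h.iteratedFDeriv ℝ k), C, ?_⟩
  intro y hy z hz
  rw [hy.2, hz.2]
  exact hC y hy.1 z hz.1

theorem holderAt_zero_iff :
    HolderAt 0 α f x ↔ ContDiffAt ℝ 0 f x ∧ ∃ U ∈ 𝓝 x, ∃ C : ℝ≥0, HolderOnWith C α f U := by
  simp only [HolderAt, CharP.cast_eq_zero, iteratedFDeriv_zero_eq_comp, HolderOnWith,
    Function.comp_apply, LinearIsometryEquiv.edist_map]

theorem contDiffAt_succ_iff_fderiv :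
    ContDiffAt ℝ (k + 1 : ℕ) f x ↔
      (∀ᶠ y in 𝓝 x, DifferentiableAt ℝ f y) ∧ ContDiffAt ℝ k (fderiv ℝ f) x := by
  push_cast
  refine ⟨fun h => ⟨?_, h.fderiv_right le_rfl⟩, fun h => contDiffAt_succ_iff_hasFDerivAt.2
    ⟨fderiv ℝ f, ⟨_, h.1, fun _ hy => DifferentiableAt.hasFDerivAt hy⟩, h.2⟩⟩
  filter_upwards [(h.of_le le_add_self).eventually (by simp)] with y hy
  exact hy.differentiableAt one_ne_zero

theorem holderAt_succ_iff :
    HolderAt (k + 1) α f x ↔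
      (∀ᶠ y in 𝓝 x, DifferentiableAt ℝ f y) ∧ HolderAt k α (fderiv ℝ f) x := by
  have hcurry : ∀ y, iteratedFDeriv ℝ (k + 1) f y =
      (continuousMultilinearCurryRightEquiv' ℝ k E F).symm (iteratedFDeriv ℝ k (fderiv ℝ f) y) :=
    fun y => iteratedFDeriv_succ_eq_comp_right
  simp only [HolderAt, contDiffAt_succ_iff_fderiv, and_assoc, HolderOnWith, hcurry,
    LinearIsometryEquiv.edist_map]

theorem exists_holderOnWith_of_contDiffAt (hα : α ≤ 1) (hf : ContDiffAt ℝ 1 f x) :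
    ∃ U ∈ 𝓝 x, ∃ C : ℝ≥0, HolderOnWith C α f U := by
  obtain ⟨K, t, ht, hK⟩ := hf.exists_lipschitzOnWith
  refine ⟨t ∩ ball x 1, inter_mem ht (ball_mem_nhds x one_pos), _,
    HolderOnWith.of_le (D := 2) (fun y hy z hz => ?_)
      (holderOnWith_one.2 (hK.mono Set.inter_subset_left)) hα⟩
  calc edist y z ≤ edist y x + edist z x := edist_triangle_right y z x
    _ ≤ ENNReal.ofReal 1 + ENNReal.ofReal 1 := by
      rw [edist_dist, edist_dist]
      gcongr
      exacts [(mem_ball.1 hy.2).le, (mem_ball.1 hz.2).le]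
    _ = (2 : ℝ≥0) := by simp [one_add_one_eq_two]

theorem holderAt_of_contDiffAt (hα : α ≤ 1) (hf : ContDiffAt ℝ (k + 1 : ℕ) f x) :
    HolderAt k α f x :=
  ⟨hf.of_le (by exact_mod_cast k.le_succ), exists_holderOnWith_of_contDiffAt hα
    (hf.iteratedFDeriv_right (by push_cast; rw [add_comm]))⟩

theorem holderAt_const (hα : α ≤ 1) (c : F) (x : E) : HolderAt k α (fun _ => c) x :=
  holderAt_of_contDiffAt hα contDiffAt_const

namespace HolderAt

theorem of_succ (hα : α ≤ 1) (hf : HolderAt (k + 1) α f x) : HolderAt k α f x :=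
  holderAt_of_contDiffAt hα hf.1

theorem fderiv_right (hf : HolderAt (k + 1) α f x) : HolderAt k α (fderiv ℝ f) x :=
  (holderAt_succ_iff.1 hf).2

theorem clm_comp (L : F →L[ℝ] F') (hf : HolderAt k α f x) : HolderAt k α (fun y => L (f y)) x := by
  obtain ⟨hdiff, U, hU, C, hC⟩ := hf
  let L' := ContinuousLinearMap.compContinuousMultilinearMapL ℝ (fun _ : Fin k => E) F F' L
  have hL : ∀ᶠ y in 𝓝 x, iteratedFDeriv ℝ k (fun y => L (f y)) y = L' (iteratedFDeriv ℝ k f y) := by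
    filter_upwards [hdiff.eventually (by simp)] with y hy
    exact L.iteratedFDeriv_comp_left hy le_rfl
  refine ⟨L.contDiff.contDiffAt.comp x hdiff, _, inter_mem hU hL, ‖L'‖₊ * C, fun y hy z hz => ?_⟩
  rw [hy.2, hz.2, ENNReal.coe_mul, mul_assoc]
  exact (L'.lipschitz _ _).trans (mul_le_mul_right (hC y hy.1 z hz.1) _)

theorem prodMk {g : E → F'} (hf : HolderAt k α f x) (hg : HolderAt k α g x) :
    HolderAt k α (fun y => (f y, g y)) x := by
  obtain ⟨hfdiff, U, hU, C, hC⟩ := hf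
  obtain ⟨hgdiff, V, hV, D, hD⟩ := hg
  have hprod : ∀ᶠ y in 𝓝 x, iteratedFDeriv ℝ k (fun y => (f y, g y)) y =
      (iteratedFDeriv ℝ k f y).prod (iteratedFDeriv ℝ k g y) := by
    filter_upwards [hfdiff.eventually (by simp), hgdiff.eventually (by simp)] with y hfy hgy
    exact iteratedFDeriv_prodMk hfy hgy le_rfl
  refine ⟨hfdiff.prodMk hgdiff, _, inter_mem (inter_mem hU hV) hprod, max C D,
    fun y hy z hz => ?_⟩
  let e := ContinuousMultilinearMap.prodL ℝ (fun _ : Fin k => E) F F'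
  rw [hy.2, hz.2]
  refine (e.edist_map (_, _) (_, _)).trans_le ?_
  rw [Prod.edist_eq, max_le_iff]
  exact ⟨hC.mono_const (le_max_left C D) y hy.1.1 z hz.1.1,
    hD.mono_const (le_max_right C D) y hy.1.2 z hz.1.2⟩

theorem add {g : E → F} (hf : HolderAt k α f x) (hg : HolderAt k α g x) :
    HolderAt k α (fun y => f y + g y) x :=
  (hf.prodMk hg).clm_comp (ContinuousLinearMap.fst ℝ F F + ContinuousLinearMap.snd ℝ F F)

theorem sum {ι : Type*} {s : Finset ι} {f : ι → E → F} (hα : α ≤ 1)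
    (hf : ∀ i ∈ s, HolderAt k α (f i) x) : HolderAt k α (fun y => ∑ i ∈ s, f i y) x := by
  classical
  induction s using Finset.induction_on with
  | empty => simpa only [Finset.sum_empty] using holderAt_const hα (0 : F) x
  | insert i s hi ih =>
    simp only [Finset.sum_insert hi]
    exact (hf i (Finset.mem_insert_self i s)).add
      (ih fun j hj => hf j (Finset.mem_insert_of_mem hj))

end HolderAt

end Holder

section HolderComposition

-- One universe for all spaces: the induction below passes from `F` to `(F →L F') × (E →L F)`.
universe u

variable {E F F' : Type u} [NormedAddCommGroup E] [NormedSpace ℝ E] [NormedAddCommGroup F]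
  [NormedSpace ℝ F] [NormedAddCommGroup F'] [NormedSpace ℝ F'] {k : ℕ} {α : ℝ≥0} {x : E}

theorem HolderAt.contDiffAt_comp {f : E → F} {Φ : F → F'} (hα : α ≤ 1) (hf : HolderAt k α f x)
    (hΦ : ContDiffAt ℝ (k + 1 : ℕ) Φ (f x)) : HolderAt k α (fun y => Φ (f y)) x := by
  induction k generalizing F F' with
  | zero =>
    rw [holderAt_zero_iff] at *
    obtain ⟨hcont, U, hU, C, hC⟩ := hf
    obtain ⟨K, t, ht, hK⟩ := (hΦ.of_le (by simp) : ContDiffAt ℝ 1 Φ (f x)).exists_lipschitzOnWith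
    refine ⟨(hΦ.of_le (by simp)).comp x hcont, U ∩ f ⁻¹' t,
      inter_mem hU (hcont.continuousAt ht), K * C, fun y hy z hz => ?_⟩
    rw [ENNReal.coe_mul, mul_assoc]
    exact (hK hy.2 hz.2).trans (mul_le_mul_right (hC y hy.1 z hz.1) _)
  | succ k ih =>
    obtain ⟨hdf, hf'⟩ := holderAt_succ_iff.1 hf
    obtain ⟨hdΦ, hΦ'⟩ := contDiffAt_succ_iff_fderiv.1 hΦ
    have hdΦf := hf.1.continuousAt.eventually hdΦ
    refine holderAt_succ_iff.2 ⟨?_, ?_⟩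
    · filter_upwards [hdf, hdΦf] with y hfy hΦy using hΦy.comp y hfy
    · have hcomp := ih (Φ := fun p : (F →L[ℝ] F') × (E →L[ℝ] F) => p.1 ∘L p.2)
        ((ih (hf.of_succ hα) hΦ').prodMk hf') isBoundedBilinearMap_comp.contDiff.contDiffAt
      refine hcomp.congr_of_eventuallyEq ?_
      filter_upwards [hdf, hdΦf] with y hfy hΦy
      exact fderiv_fun_comp y hΦy hfy

theorem HolderAt.clm_apply {f : E → F →L[ℝ] F'} {g : E → F} (hα : α ≤ 1)
    (hf : HolderAt k α f x) (hg : HolderAt k α g x) : HolderAt k α (fun y => f y (g y)) x :=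
  (hf.prodMk hg).contDiffAt_comp (Φ := fun p : (F →L[ℝ] F') × F => p.1 p.2) hα
    isBoundedBilinearMap_apply.contDiff.contDiffAt

end HolderComposition

/-! ### Christoffel symbols -/

section Christoffel

theorem hasFDerivAt_clm_apply_const {A B F : Type*} [NormedAddCommGroup A] [NormedSpace ℝ A]
    [NormedAddCommGroup B] [NormedSpace ℝ B] [NormedAddCommGroup F] [NormedSpace ℝ F]
    {T : F → A →L[ℝ] B} {T' : F →L[ℝ] A →L[ℝ] B} {y : F} (h : HasFDerivAt T T' y) (a : A) :
    HasFDerivAt (fun t => T t a) (T'.flip a) y := by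
  simpa only [ContinuousLinearMap.comp_zero, zero_add] using h.clm_apply (hasFDerivAt_const a y)

variable {n : ℕ}

/-- The exchange of the two arguments of a bilinear map, as a continuous linear map. -/
def flipCLM (F : Type*) [NormedAddCommGroup F] [NormedSpace ℝ F] :
    (Coord n →L[ℝ] Coord n →L[ℝ] F) →L[ℝ] Coord n →L[ℝ] Coord n →L[ℝ] F :=
  (ContinuousLinearMap.flipₗᵢ ℝ (Coord n) (Coord n) F).toContinuousLinearEquiv

/-- The Christoffel symbols of the first kind as a continuous linear function of the derivative
`D u v w = ∂_u G (v, w)` of the metric. -/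
def christoffelLowerL : (Coord n →L[ℝ] Coord n →L[ℝ] Coord n →L[ℝ] ℝ) →L[ℝ]
    Coord n →L[ℝ] Coord n →L[ℝ] Coord n →L[ℝ] ℝ :=
  (1 / 2 : ℝ) • (.id ℝ _ + flipCLM (Coord n →L[ℝ] ℝ) -
    .compL ℝ (Coord n) (Coord n →L[ℝ] Coord n →L[ℝ] ℝ) (Coord n →L[ℝ] Coord n →L[ℝ] ℝ)
      (flipCLM ℝ) ∘L flipCLM (Coord n →L[ℝ] ℝ))

/-- The Christoffel symbols as a function of the value and the derivative of the metric. -/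
def christoffelOfJet (p : (Coord n →L[ℝ] Coord n →L[ℝ] ℝ) ×
    (Coord n →L[ℝ] Coord n →L[ℝ] Coord n →L[ℝ] ℝ)) : Coord n →L[ℝ] Coord n →L[ℝ] Coord n :=
  .compL ℝ (Coord n) (Coord n →L[ℝ] ℝ) (Coord n) p.1.inverse ∘L christoffelLowerL p.2

/-- The field of bilinear maps `y ↦ Γ(·, ·)` with values `christoffel G y u v`. -/
def christoffelMap (G : Coord n → Coord n →L[ℝ] Coord n →L[ℝ] ℝ) (y : Coord n) :
    Coord n →L[ℝ] Coord n →L[ℝ] Coord n :=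
  christoffelOfJet (G y, fderiv ℝ G y)

/-- `G` is a Riemannian metric of class `C²` near `y`. -/
structure IsMetricAt (G : Coord n → Coord n →L[ℝ] Coord n →L[ℝ] ℝ) (y : Coord n) : Prop where
  contDiffAt : ContDiffAt ℝ 2 G y
  isInnerProduct : ∀ᶠ z in 𝓝 y, IsInnerProduct (G z)

variable {G : Coord n → Coord n →L[ℝ] Coord n →L[ℝ] ℝ} {y : Coord n}

theorem christoffelLowerL_apply (D : Coord n →L[ℝ] Coord n →L[ℝ] Coord n →L[ℝ] ℝ)
    (u v w : Coord n) :
    christoffelLowerL D u v w = 1 / 2 * (D u v w + D v u w - D w u v) := rfl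

theorem christoffel_eq_christoffelMap (G : Coord n → Coord n →L[ℝ] Coord n →L[ℝ] ℝ)
    (y u v : Coord n) : christoffel G y u v = christoffelMap G y u v := rfl

theorem contDiffAt_christoffelOfJet {p : (Coord n →L[ℝ] Coord n →L[ℝ] ℝ) ×
    (Coord n →L[ℝ] Coord n →L[ℝ] Coord n →L[ℝ] ℝ)} (hp : p.1.IsInvertible) (m : WithTop ℕ∞) :
    ContDiffAt ℝ m christoffelOfJet p :=
  ((ContinuousLinearMap.contDiff _).contDiffAt.comp p
    (hp.contDiffAt_map_inverse.comp p contDiffAt_fst)).clm_comp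
      (christoffelLowerL.contDiff.contDiffAt.comp p contDiffAt_snd)

namespace IsMetricAt

theorem self (h : IsMetricAt G y) : IsInnerProduct (G y) := h.isInnerProduct.self_of_nhds

theorem eventually (h : IsMetricAt G y) : ∀ᶠ z in 𝓝 y, IsMetricAt G z := by
  filter_upwards [h.contDiffAt.eventually (by simp), h.isInnerProduct.eventually_nhds] with z h₁ h₂
  exact ⟨h₁, h₂⟩

theorem differentiableAt (h : IsMetricAt G y) : DifferentiableAt ℝ G y :=
  h.contDiffAt.differentiableAt two_ne_zero

theorem contDiffAt_fderiv (h : IsMetricAt G y) : ContDiffAt ℝ 1 (fderiv ℝ G) y :=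
  h.contDiffAt.fderiv_right one_add_one_eq_two.le

theorem differentiableAt_fderiv (h : IsMetricAt G y) : DifferentiableAt ℝ (fderiv ℝ G) y :=
  h.contDiffAt_fderiv.differentiableAt one_ne_zero

theorem differentiableAt_christoffelMap (h : IsMetricAt G y) :
    DifferentiableAt ℝ (christoffelMap G) y :=
  ((contDiffAt_christoffelOfJet (p := (G y, fderiv ℝ G y)) h.self.isInvertible 1).comp y
    ((h.contDiffAt.of_le one_le_two).prodMk h.contDiffAt_fderiv)).differentiableAt one_ne_zero

theorem fderiv_symm (h : IsMetricAt G y) (u v w : Coord n) :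
    fderiv ℝ G y u v w = fderiv ℝ G y u w v := by
  have hsymm : (fun z => G z v w) =ᶠ[𝓝 y] fun z => G z w v := by
    filter_upwards [h.isInnerProduct] with z hz using hz.symm v w
  have hderiv := fun a b => hasFDerivAt_clm_apply_const
    (hasFDerivAt_clm_apply_const h.differentiableAt.hasFDerivAt a) b
  exact congr($(((hderiv v w).congr_of_eventuallyEq hsymm.symm).unique (hderiv w v)) u)

theorem fderiv_fderiv_comm (h : IsMetricAt G y) (u v : Coord n) :
    fderiv ℝ (fderiv ℝ G) y u v = fderiv ℝ (fderiv ℝ G) y v u :=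
  h.contDiffAt.isSymmSndFDerivAt (by simp) u v

theorem fderiv_fderiv_symm (h : IsMetricAt G y) (t u v w : Coord n) :
    fderiv ℝ (fderiv ℝ G) y t u v w = fderiv ℝ (fderiv ℝ G) y t u w v := by
  have hsymm : (fun z => fderiv ℝ G z u v w) =ᶠ[𝓝 y] fun z => fderiv ℝ G z u w v := by
    filter_upwards [h.eventually] with z hz using hz.fderiv_symm u v w
  have hderiv := fun a b => hasFDerivAt_clm_apply_const (hasFDerivAt_clm_apply_const
    (hasFDerivAt_clm_apply_const h.differentiableAt_fderiv.hasFDerivAt u) a) b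
  exact congr($(((hderiv v w).congr_of_eventuallyEq hsymm.symm).unique (hderiv w v)) t)

theorem metric_christoffelMap (h : IsMetricAt G y) (u v w : Coord n) :
    G y (christoffelMap G y u v) w =
      1 / 2 * (fderiv ℝ G y u v w + fderiv ℝ G y v u w - fderiv ℝ G y w u v) := by
  have hlower : G y (christoffelMap G y u v) = christoffelLowerL (fderiv ℝ G y) u v :=
    h.self.apply_inverse _
  rw [hlower, christoffelLowerL_apply]

theorem christoffelMap_symm (h : IsMetricAt G y) (u v : Coord n) :
    christoffelMap G y u v = christoffelMap G y v u := by
  refine h.self.isInvertible.injective (ContinuousLinearMap.ext fun w => ?_)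
  rw [h.metric_christoffelMap, h.metric_christoffelMap, h.fderiv_symm w u v]
  ring

theorem hasFDerivAt_christoffel (h : IsMetricAt G y) (v w : Coord n) :
    HasFDerivAt (fun z => christoffel G z v w)
      (((fderiv ℝ (christoffelMap G) y).flip v).flip w) y :=
  hasFDerivAt_clm_apply_const
    (hasFDerivAt_clm_apply_const h.differentiableAt_christoffelMap.hasFDerivAt v) w

theorem riemann_eq (h : IsMetricAt G y) (u v w : Coord n) :
    riemann G y u v w = fderiv ℝ (christoffelMap G) y u v w - fderiv ℝ (christoffelMap G) y v u w
      + christoffelMap G y u (christoffelMap G y v w)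
      - christoffelMap G y v (christoffelMap G y u w) := by
  rw [riemann, (h.hasFDerivAt_christoffel v w).fderiv, (h.hasFDerivAt_christoffel u w).fderiv]
  rfl

theorem metric_fderiv_christoffelMap (h : IsMetricAt G y) (u v w z : Coord n) :
    G y (fderiv ℝ (christoffelMap G) y u v w) z =
      1 / 2 * (fderiv ℝ (fderiv ℝ G) y u v w z + fderiv ℝ (fderiv ℝ G) y u w v z -
        fderiv ℝ (fderiv ℝ G) y u z v w) - fderiv ℝ G y u (christoffelMap G y v w) z := by
  have hlower : (fun t => G t (christoffel G t v w) z) =ᶠ[𝓝 y]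
      fun t => christoffelLowerL (fderiv ℝ G t) v w z := by
    filter_upwards [h.eventually] with t ht
    rw [christoffel_eq_christoffelMap, ht.metric_christoffelMap, christoffelLowerL_apply]
  have hleft := hasFDerivAt_clm_apply_const
    (h.differentiableAt.hasFDerivAt.clm_apply (h.hasFDerivAt_christoffel v w)) z
  have hright := hasFDerivAt_clm_apply_const (hasFDerivAt_clm_apply_const
    (hasFDerivAt_clm_apply_const ((ContinuousLinearMap.hasFDerivAt christoffelLowerL).comp y
      h.differentiableAt_fderiv.hasFDerivAt) v) w) z
  have hu := congr($((hright.congr_of_eventuallyEq hlower).unique hleft) u)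
  simp only [ContinuousLinearMap.flip_apply, ContinuousLinearMap.comp_apply, add_apply,
    christoffelLowerL_apply, christoffel_eq_christoffelMap] at hu
  linarith

theorem metric_riemann (h : IsMetricAt G y) (u v w z : Coord n) :
    G y (riemann G y u v w) z =
      1 / 2 * (fderiv ℝ (fderiv ℝ G) y u w v z - fderiv ℝ (fderiv ℝ G) y u z v w -
        fderiv ℝ (fderiv ℝ G) y v w u z + fderiv ℝ (fderiv ℝ G) y v z u w) -
      G y (christoffelMap G y u z) (christoffelMap G y v w) +
      G y (christoffelMap G y v z) (christoffelMap G y u w) := by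
  rw [h.riemann_eq]
  simp only [map_add, map_sub, add_apply, sub_apply, h.metric_fderiv_christoffelMap,
    h.metric_christoffelMap]
  rw [h.fderiv_fderiv_comm u v, h.fderiv_symm u z, h.fderiv_symm v z]
  ring

theorem metric_riemann_pair_symm (h : IsMetricAt G y) (u v w z : Coord n) :
    G y (riemann G y u v w) z = G y (riemann G y w z u) v := by
  rw [h.metric_riemann, h.metric_riemann, h.fderiv_fderiv_comm w u, h.fderiv_fderiv_comm w v,
    h.fderiv_fderiv_comm z u, h.fderiv_fderiv_comm z v, h.fderiv_fderiv_symm u w v z,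
    h.fderiv_fderiv_symm v w u z, h.fderiv_fderiv_symm u z v w, h.fderiv_fderiv_symm v z u w,
    h.christoffelMap_symm z u, h.christoffelMap_symm w v, h.christoffelMap_symm w u,
    h.christoffelMap_symm z v, h.self.symm (christoffelMap G y u z)]
  ring

theorem metric_riemann_antisymm (h : IsMetricAt G y) (u v w z : Coord n) :
    G y (riemann G y u v w) z = - G y (riemann G y v u w) z := by
  rw [h.metric_riemann, h.metric_riemann]
  ring

end IsMetricAt

end Christoffel

/-! ### Ricci curvature -/

section Ricci

variable {n : ℕ} {G : Coord n → Coord n →L[ℝ] Coord n →L[ℝ] ℝ} {y : Coord n}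

/-- The trilinear map `Γ(u, Γ(v, w))`, for `Γ` the Christoffel symbols at a point. -/
def christoffelComp (Γ : Coord n →L[ℝ] Coord n →L[ℝ] Coord n) :
    Coord n →L[ℝ] Coord n →L[ℝ] Coord n →L[ℝ] Coord n :=
  (ContinuousLinearMap.compL ℝ (Coord n) (Coord n →L[ℝ] Coord n)
    (Coord n →L[ℝ] Coord n)).flip Γ ∘L .compL ℝ (Coord n) (Coord n) (Coord n) ∘L Γ

/-- The trilinear map `R(u, v) w = (D_u Γ)(v, w) - (D_v Γ)(u, w) + Γ(u, Γ(v, w)) - Γ(v, Γ(u, w))`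
assembled from the Christoffel symbols `Γ` and their derivative `D`. -/
def curvatureOf (Γ : Coord n →L[ℝ] Coord n →L[ℝ] Coord n)
    (D : Coord n →L[ℝ] Coord n →L[ℝ] Coord n →L[ℝ] Coord n) :
    Coord n →L[ℝ] Coord n →L[ℝ] Coord n →L[ℝ] Coord n :=
  (.id ℝ _ - flipCLM (Coord n →L[ℝ] Coord n)) (D + christoffelComp Γ)

/-- The Ricci curvature, assembled from the Christoffel symbols and their derivative as a field of
bilinear forms; where `G` is a `C²` metric its values are `ricciLocal G y v w`. -/
def ricciForm (G : Coord n → Coord n →L[ℝ] Coord n →L[ℝ] ℝ) (y : Coord n) :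
    Coord n →L[ℝ] Coord n →L[ℝ] ℝ :=
  ∑ i : Fin n, .compL ℝ (Coord n) (Coord n) ℝ (EuclideanSpace.proj i) ∘L
    curvatureOf (christoffelMap G y) (fderiv ℝ (christoffelMap G) y) (EuclideanSpace.single i 1)

theorem contDiff_christoffelComp {m : WithTop ℕ∞} :
    ContDiff ℝ m (christoffelComp : (Coord n →L[ℝ] Coord n →L[ℝ] Coord n) → _) :=
  (ContinuousLinearMap.contDiff _).clm_comp (contDiff_const.clm_comp contDiff_id)

theorem curvatureOf_apply (Γ : Coord n →L[ℝ] Coord n →L[ℝ] Coord n)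
    (D : Coord n →L[ℝ] Coord n →L[ℝ] Coord n →L[ℝ] Coord n) (u v w : Coord n) :
    curvatureOf Γ D u v w = D u v w + Γ u (Γ v w) - (D v u w + Γ v (Γ u w)) := rfl

namespace IsMetricAt

theorem riemann_eq_curvatureOf (h : IsMetricAt G y) (u v w : Coord n) :
    riemann G y u v w =
      curvatureOf (christoffelMap G y) (fderiv ℝ (christoffelMap G) y) u v w := by
  rw [h.riemann_eq, curvatureOf_apply]
  abel

theorem ricciForm_apply (h : IsMetricAt G y) (v w : Coord n) :
    ricciForm G y v w = ricciLocal G y v w := by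
  simp [ricciForm, ricciLocal, h.riemann_eq_curvatureOf]

theorem ricciLocal_eq_sum {ι : Type*} [Fintype ι] [DecidableEq ι] {b : Basis ι ℝ (Coord n)}
    (h : IsMetricAt G y) (hb : IsOrthonormal (G y) b) (v w : Coord n) :
    ricciLocal G y v w = ∑ i, G y (riemann G y (b i) v w) (b i) := by
  let R := curvatureOf (christoffelMap G y) (fderiv ℝ (christoffelMap G) y)
  have htrace : ricciLocal G y v w =
      LinearMap.trace ℝ (Coord n) ((R.flip v).flip w : Coord n →L[ℝ] Coord n) := by
    rw [LinearMap.trace_eq_matrix_trace ℝ (EuclideanSpace.basisFun (Fin n) ℝ).toBasis,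
      Matrix.trace]
    simp [ricciLocal, LinearMap.toMatrix_apply, h.riemann_eq_curvatureOf, R]
  rw [htrace, hb.trace_eq_sum]
  simp only [h.riemann_eq_curvatureOf]
  rfl

theorem ricciLocal_symm (h : IsMetricAt G y) (v w : Coord n) :
    ricciLocal G y v w = ricciLocal G y w v := by
  obtain ⟨b, hb⟩ := h.self.exists_orthonormal_basis
  rw [h.ricciLocal_eq_sum hb, h.ricciLocal_eq_sum hb]
  refine Finset.sum_congr rfl fun i _ => ?_
  calc G y (riemann G y (b i) v w) (b i) = G y (riemann G y w (b i) (b i)) v :=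
        h.metric_riemann_pair_symm _ _ _ _
    _ = -G y (riemann G y (b i) w (b i)) v := h.metric_riemann_antisymm _ _ _ _
    _ = -G y (riemann G y (b i) v (b i)) w := by rw [h.metric_riemann_pair_symm]
    _ = G y (riemann G y v (b i) (b i)) w := (h.metric_riemann_antisymm _ _ _ _).symm
    _ = G y (riemann G y (b i) w v) (b i) := h.metric_riemann_pair_symm _ _ _ _

theorem exists_gaussMap_eq_ricciForm (h : IsMetricAt G y) (hn : 3 ≤ n)
    (hK : ∀ u v : Coord n, LinearIndependent ℝ ![u, v] → 0 < G y (riemann G y u v v) u) :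
    ∃ X, IsInnerProduct X ∧ gaussMap (G y) X = ricciForm G y := by
  obtain ⟨b, r, hb, hr⟩ := h.self.exists_orthonormal_diagonalizing (M := ricciForm G y)
    fun u v => by rw [h.ricciForm_apply, h.ricciForm_apply, h.ricciLocal_symm]
  let K i j := G y (riemann G y (b i) (b j) (b j)) (b i)
  have hKsymm : ∀ i j, K i j = K j i := fun i j => h.metric_riemann_pair_symm _ _ _ _
  have hKpos : ∀ i j, i ≠ j → 0 < K i j := fun i j hij =>
    hK _ _ (LinearIndependent.pair_iff.2
      ((LinearIndepOn.pair_iff b hij).1 (b.linearIndependent.linearIndepOn _)))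
  have hKdiag : ∀ i, K i i = 0 := fun i => self_eq_neg.1 (h.metric_riemann_antisymm _ _ _ _)
  have hricci : ∀ i, r i = ∑ k ∈ {i}ᶜ, K i k := fun i =>
    calc r i = ricciLocal G y (b i) (b i) := by
          rw [← h.ricciForm_apply, hr, smul_apply, hb, if_pos rfl, smul_eq_mul, mul_one]
      _ = ∑ k, K i k := by
          rw [h.ricciLocal_eq_sum hb]
          exact Finset.sum_congr rfl fun k _ => hKsymm k i
      _ = ∑ k ∈ {i}ᶜ, K i k := by rw [Fintype.sum_eq_add_sum_compl i, hKdiag, zero_add]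
  obtain ⟨X, hX, hXK⟩ := exists_isInnerProduct_gaussMap_apply_basis
    (by rwa [Fintype.card_fin, finrank_euclideanSpace_fin]) h.self hb hKsymm hKpos
  refine ⟨X, hX, bilin_ext b fun i j => ?_⟩
  rw [hXK, hr, smul_apply, hb, smul_eq_mul, mul_ite, mul_one, mul_zero, hricci]

end IsMetricAt

namespace HolderAt

variable {k : ℕ} {α : ℝ≥0}

theorem christoffelMap (hα : α ≤ 1) (hG : HolderAt (k + 1) α G y) (hinv : (G y).IsInvertible) :
    HolderAt k α (christoffelMap G) y :=
  ((hG.of_succ hα).prodMk hG.fderiv_right).contDiffAt_comp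
    (Φ := christoffelOfJet) hα (contDiffAt_christoffelOfJet hinv _)

theorem curvatureOf {Γ : Coord n → Coord n →L[ℝ] Coord n →L[ℝ] Coord n}
    {D : Coord n → Coord n →L[ℝ] Coord n →L[ℝ] Coord n →L[ℝ] Coord n} (hα : α ≤ 1)
    (hΓ : HolderAt k α Γ y) (hD : HolderAt k α D y) :
    HolderAt k α (fun z => curvatureOf (Γ z) (D z)) y := by
  exact (hD.add (hΓ.contDiffAt_comp hα contDiff_christoffelComp.contDiffAt)).clm_comp _

theorem ricciForm (hα : α ≤ 1) (hG : HolderAt (k + 2) α G y) (hinv : (G y).IsInvertible) :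
    HolderAt k α (ricciForm G) y := by
  have hΓ : HolderAt (k + 1) α (SphereGauss.christoffelMap G) y := hG.christoffelMap hα hinv
  have hR := (hΓ.of_succ hα).curvatureOf hα hΓ.fderiv_right
  exact .sum hα fun i _ =>
    (hR.clm_apply hα (holderAt_const hα (EuclideanSpace.single i 1) y)).clm_comp
      (.compL ℝ (Coord n) (Coord n →L[ℝ] Coord n) (Coord n →L[ℝ] ℝ)
        (.compL ℝ (Coord n) (Coord n) ℝ (EuclideanSpace.proj i)))

end HolderAt

end Ricci

/-! ### Changes of coordinates -/

section Pullback

variable {n : ℕ} {G G' : Coord n → Coord n →L[ℝ] Coord n →L[ℝ] ℝ} {ψ : Coord n → Coord n}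
  {y : Coord n}

/-- Near `y`, the metric `G'` is the pull-back of the metric `G` under `ψ`. -/
structure IsPullbackAt (ψ : Coord n → Coord n) (G' G : Coord n → Coord n →L[ℝ] Coord n →L[ℝ] ℝ)
    (y : Coord n) : Prop where
  contDiffAt : ContDiffAt ℝ 3 ψ y
  source : IsMetricAt G' y
  target : IsMetricAt G (ψ y)
  eq : ∀ᶠ z in 𝓝 y, ∀ u v, G' z u v = G (ψ z) (fderiv ℝ ψ z u) (fderiv ℝ ψ z v)

namespace IsPullbackAt

theorem eventually (h : IsPullbackAt ψ G' G y) : ∀ᶠ z in 𝓝 y, IsPullbackAt ψ G' G z := by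
  filter_upwards [h.contDiffAt.eventually (by simp), h.source.eventually,
    h.contDiffAt.continuousAt.eventually h.target.eventually, h.eq.eventually_nhds]
    with z hψ hsource htarget heq
  exact ⟨hψ, hsource, htarget, heq⟩

theorem hasFDerivAt (h : IsPullbackAt ψ G' G y) : HasFDerivAt ψ (fderiv ℝ ψ y) y :=
  (h.contDiffAt.differentiableAt three_ne_zero).hasFDerivAt

theorem contDiffAt_fderiv (h : IsPullbackAt ψ G' G y) : ContDiffAt ℝ 2 (fderiv ℝ ψ) y :=
  h.contDiffAt.fderiv_right (by norm_num)

theorem hasFDerivAt_fderiv (h : IsPullbackAt ψ G' G y) :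
    HasFDerivAt (fderiv ℝ ψ) (fderiv ℝ (fderiv ℝ ψ) y) y :=
  (h.contDiffAt_fderiv.differentiableAt two_ne_zero).hasFDerivAt

theorem hasFDerivAt_fderiv_fderiv (h : IsPullbackAt ψ G' G y) :
    HasFDerivAt (fderiv ℝ (fderiv ℝ ψ)) (fderiv ℝ (fderiv ℝ (fderiv ℝ ψ)) y) y :=
  ((h.contDiffAt_fderiv.fderiv_right (m := 1) (by norm_num)).differentiableAt
    one_ne_zero).hasFDerivAt

theorem fderiv_fderiv_comm (h : IsPullbackAt ψ G' G y) (u v : Coord n) :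
    fderiv ℝ (fderiv ℝ ψ) y u v = fderiv ℝ (fderiv ℝ ψ) y v u :=
  h.contDiffAt.isSymmSndFDerivAt (by simp; norm_num) u v

theorem third_fderiv_comm (h : IsPullbackAt ψ G' G y) (u v : Coord n) :
    fderiv ℝ (fderiv ℝ (fderiv ℝ ψ)) y u v = fderiv ℝ (fderiv ℝ (fderiv ℝ ψ)) y v u :=
  h.contDiffAt_fderiv.isSymmSndFDerivAt (by simp) u v

theorem injective_fderiv (h : IsPullbackAt ψ G' G y) : Function.Injective (fderiv ℝ ψ y) := by
  refine (injective_iff_map_eq_zero _).2 fun u hu => by_contra fun hu0 => ?_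
  have hpos := h.source.self.pos u hu0
  rw [h.eq.self_of_nhds, hu, map_zero] at hpos
  exact hpos.false

/-- The differential of the change of coordinates at `y`, a linear isomorphism because the two
metrics are nondegenerate. -/
def fderivEquiv (h : IsPullbackAt ψ G' G y) : Coord n ≃ₗ[ℝ] Coord n :=
  .ofInjectiveEndo (fderiv ℝ ψ y : Coord n →ₗ[ℝ] Coord n) h.injective_fderiv

theorem fderivEquiv_apply (h : IsPullbackAt ψ G' G y) (u : Coord n) :
    h.fderivEquiv u = fderiv ℝ ψ y u :=
  rfl

theorem fderiv_metric (h : IsPullbackAt ψ G' G y) (u v w : Coord n) :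
    fderiv ℝ G' y u v w =
      fderiv ℝ G (ψ y) (fderiv ℝ ψ y u) (fderiv ℝ ψ y v) (fderiv ℝ ψ y w) +
      G (ψ y) (fderiv ℝ (fderiv ℝ ψ) y u v) (fderiv ℝ ψ y w) +
      G (ψ y) (fderiv ℝ ψ y v) (fderiv ℝ (fderiv ℝ ψ) y u w) := by
  have heq : (fun z => G' z v w) =ᶠ[𝓝 y]
      fun z => G (ψ z) (fderiv ℝ ψ z v) (fderiv ℝ ψ z w) := by
    filter_upwards [h.eq] with z hz using hz v w
  have hG : HasFDerivAt (fun z => G (ψ z)) (fderiv ℝ G (ψ y) ∘L fderiv ℝ ψ y) y :=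
    h.target.differentiableAt.hasFDerivAt.comp y h.hasFDerivAt
  have hpull := (hG.clm_apply (hasFDerivAt_clm_apply_const h.hasFDerivAt_fderiv v)).clm_apply
    (hasFDerivAt_clm_apply_const h.hasFDerivAt_fderiv w)
  have hG' := hasFDerivAt_clm_apply_const (hasFDerivAt_clm_apply_const
    h.source.differentiableAt.hasFDerivAt v) w
  have hu := congr($(hG'.unique (hpull.congr_of_eventuallyEq heq)) u)
  simp only [ContinuousLinearMap.flip_apply, ContinuousLinearMap.comp_apply, add_apply] at hu
  linarith

theorem christoffel (h : IsPullbackAt ψ G' G y) (u v : Coord n) :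
    fderiv ℝ ψ y (christoffelMap G' y u v) = fderiv ℝ (fderiv ℝ ψ) y u v +
      christoffelMap G (ψ y) (fderiv ℝ ψ y u) (fderiv ℝ ψ y v) := by
  refine h.target.self.isInvertible.injective (ContinuousLinearMap.ext fun z => ?_)
  obtain ⟨w, rfl⟩ := h.fderivEquiv.surjective z
  rw [h.fderivEquiv_apply, ← h.eq.self_of_nhds, h.source.metric_christoffelMap, map_add, add_apply,
    h.target.metric_christoffelMap, h.fderiv_metric, h.fderiv_metric, h.fderiv_metric,
    h.fderiv_fderiv_comm v u, h.fderiv_fderiv_comm w u, h.fderiv_fderiv_comm w v,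
    h.target.self.symm (fderiv ℝ (fderiv ℝ ψ) y u w)]
  ring

theorem fderiv_christoffel (h : IsPullbackAt ψ G' G y) (u v w : Coord n) :
    fderiv ℝ (fderiv ℝ ψ) y u (christoffelMap G' y v w) +
      fderiv ℝ ψ y (fderiv ℝ (christoffelMap G') y u v w) =
    fderiv ℝ (fderiv ℝ (fderiv ℝ ψ)) y u v w +
      (fderiv ℝ (christoffelMap G) (ψ y) (fderiv ℝ ψ y u) (fderiv ℝ ψ y v) (fderiv ℝ ψ y w) +
      christoffelMap G (ψ y) (fderiv ℝ (fderiv ℝ ψ) y u v) (fderiv ℝ ψ y w) +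
      christoffelMap G (ψ y) (fderiv ℝ ψ y v) (fderiv ℝ (fderiv ℝ ψ) y u w)) := by
  have heq : (fun z => fderiv ℝ ψ z (christoffelMap G' z v w)) =ᶠ[𝓝 y]
      fun z => fderiv ℝ (fderiv ℝ ψ) z v w +
        christoffelMap G (ψ z) (fderiv ℝ ψ z v) (fderiv ℝ ψ z w) := by
    filter_upwards [h.eventually] with z hz using hz.christoffel v w
  have hleft := h.hasFDerivAt_fderiv.clm_apply
    (hasFDerivAt_clm_apply_const (hasFDerivAt_clm_apply_const
      h.source.differentiableAt_christoffelMap.hasFDerivAt v) w)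
  have hΓ : HasFDerivAt (fun z => christoffelMap G (ψ z))
      (fderiv ℝ (christoffelMap G) (ψ y) ∘L fderiv ℝ ψ y) y :=
    h.target.differentiableAt_christoffelMap.hasFDerivAt.comp y h.hasFDerivAt
  have hright := (hasFDerivAt_clm_apply_const (hasFDerivAt_clm_apply_const
    h.hasFDerivAt_fderiv_fderiv v) w).add
    ((hΓ.clm_apply (hasFDerivAt_clm_apply_const h.hasFDerivAt_fderiv v)).clm_apply
      (hasFDerivAt_clm_apply_const h.hasFDerivAt_fderiv w))
  have hu := congr($(hleft.unique (hright.congr_of_eventuallyEq heq)) u)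
  simp only [ContinuousLinearMap.flip_apply, ContinuousLinearMap.comp_apply, add_apply] at hu
  rw [add_comm, hu]
  abel

theorem fderiv_christoffel_add (h : IsPullbackAt ψ G' G y) (u v w : Coord n) :
    fderiv ℝ ψ y (fderiv ℝ (christoffelMap G') y u v w) +
      fderiv ℝ ψ y (christoffelMap G' y u (christoffelMap G' y v w)) =
    fderiv ℝ (fderiv ℝ (fderiv ℝ ψ)) y u v w +
      fderiv ℝ (christoffelMap G) (ψ y) (fderiv ℝ ψ y u) (fderiv ℝ ψ y v) (fderiv ℝ ψ y w) +
      christoffelMap G (ψ y) (fderiv ℝ (fderiv ℝ ψ) y u v) (fderiv ℝ ψ y w) +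
      (christoffelMap G (ψ y) (fderiv ℝ ψ y v) (fderiv ℝ (fderiv ℝ ψ) y u w) +
      christoffelMap G (ψ y) (fderiv ℝ ψ y u) (fderiv ℝ (fderiv ℝ ψ) y v w)) +
      christoffelMap G (ψ y) (fderiv ℝ ψ y u)
        (christoffelMap G (ψ y) (fderiv ℝ ψ y v) (fderiv ℝ ψ y w)) := by
  have hderiv := h.fderiv_christoffel u v w
  rw [add_comm] at hderiv
  rw [h.christoffel u, h.christoffel v w, map_add, eq_sub_of_add_eq hderiv]
  abel

theorem riemann (h : IsPullbackAt ψ G' G y) (u v w : Coord n) :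
    fderiv ℝ ψ y (riemann G' y u v w) =
      riemann G (ψ y) (fderiv ℝ ψ y u) (fderiv ℝ ψ y v) (fderiv ℝ ψ y w) := by
  -- The derivatives of `ψ` of order two and three enter symmetrically in `u` and `v`.
  rw [h.source.riemann_eq, h.target.riemann_eq, add_sub_assoc, sub_add_sub_comm, map_sub, map_add,
    map_add, h.fderiv_christoffel_add u v w, h.fderiv_christoffel_add v u w,
    h.third_fderiv_comm v u, h.fderiv_fderiv_comm v u]
  abel

theorem isOrthonormal_map (h : IsPullbackAt ψ G' G y) {ι : Type*} [DecidableEq ι]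
    {b : Basis ι ℝ (Coord n)} (hb : IsOrthonormal (G' y) b) :
    IsOrthonormal (G (ψ y)) (b.map h.fderivEquiv) := fun i j => by
  rw [Basis.map_apply, Basis.map_apply, h.fderivEquiv_apply, h.fderivEquiv_apply,
    ← h.eq.self_of_nhds, hb]

theorem ricciLocal (h : IsPullbackAt ψ G' G y) (v w : Coord n) :
    ricciLocal G' y v w = ricciLocal G (ψ y) (fderiv ℝ ψ y v) (fderiv ℝ ψ y w) := by
  obtain ⟨b, hb⟩ := h.source.self.exists_orthonormal_basis
  rw [h.source.ricciLocal_eq_sum hb, h.target.ricciLocal_eq_sum (h.isOrthonormal_map hb)]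
  refine Finset.sum_congr rfl fun i _ => ?_
  rw [Basis.map_apply, h.fderivEquiv_apply, ← h.riemann, ← h.eq.self_of_nhds]

end IsPullbackAt

end Pullback

/-! ### Charts of the sphere -/

section Charts

theorem contMDiffAt_mfderiv_apply {E E' H' M' : Type*} [NormedAddCommGroup E] [NormedSpace ℝ E]
    [NormedAddCommGroup E'] [NormedSpace ℝ E'] [TopologicalSpace H'] {I' : ModelWithCorners ℝ E' H'}
    [TopologicalSpace M'] [ChartedSpace H' M'] [IsManifold I' 1 M'] {f : E → M'} {x : E}
    {m k : WithTop ℕ∞} (hf : ContMDiffAt 𝓘(ℝ, E) I' k f x) (hmk : m + 1 ≤ k) (u : E) :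
    ContMDiffAt 𝓘(ℝ, E) I'.tangent m
      (fun t => TotalSpace.mk' E' (E := fun y : M' => TangentSpace I' y) (f t)
        (mfderiv 𝓘(ℝ, E) I' f t u)) x := by
  have hconst : ContMDiffAt 𝓘(ℝ, E) 𝓘(ℝ, E).tangent m
      (fun t => TotalSpace.mk' E (E := fun y : E => TangentSpace 𝓘(ℝ, E) y) t u) x := by
    rw [contMDiffAt_totalSpace]
    exact ⟨contMDiffAt_id, by simpa using contMDiffAt_const⟩
  exact (hf.mfderiv_const hmk).clm_apply_of_inCoordinates hconst
    (hf.of_le (le_self_add.trans hmk))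

theorem mfderiv_eq_comp_fderiv {E F E' H' M' : Type*} [NormedAddCommGroup E] [NormedSpace ℝ E]
    [NormedAddCommGroup F] [NormedSpace ℝ F] [NormedAddCommGroup E'] [NormedSpace ℝ E']
    [TopologicalSpace H'] {I' : ModelWithCorners ℝ E' H'} [TopologicalSpace M'] [ChartedSpace H' M']
    {φ : E → M'} {φ' : F → M'} {ψ : E → F} {z : E} (h : φ =ᶠ[𝓝 z] φ' ∘ ψ)
    (hφ' : MDifferentiableAt 𝓘(ℝ, F) I' φ' (ψ z)) (hψ : DifferentiableAt ℝ ψ z) :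
    (mfderiv 𝓘(ℝ, E) I' φ z : E →L[ℝ] E') =
      (mfderiv 𝓘(ℝ, F) I' φ' (ψ z) : F →L[ℝ] E') ∘L fderiv ℝ ψ z := by
  have hcomp := mfderiv_comp z hφ' hψ.mdifferentiableAt
  rw [mfderiv_eq_fderiv] at hcomp
  exact h.mfderiv_eq.trans hcomp

theorem contMDiffAt_inner {EB HB B F EM HM M : Type*} [NormedAddCommGroup EB]
    [NormedSpace ℝ EB] [TopologicalSpace HB] {IB : ModelWithCorners ℝ EB HB} {m : WithTop ℕ∞}
    [TopologicalSpace B] [ChartedSpace HB B] [NormedAddCommGroup F] [NormedSpace ℝ F]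
    {E : B → Type*} [TopologicalSpace (TotalSpace F E)] [∀ x, AddCommGroup (E x)]
    [∀ x, Module ℝ (E x)] [∀ x, TopologicalSpace (E x)] [∀ x, IsTopologicalAddGroup (E x)]
    [∀ x, ContinuousSMul ℝ (E x)] [FiberBundle F E] [VectorBundle ℝ F E] [NormedAddCommGroup EM]
    [NormedSpace ℝ EM] [TopologicalSpace HM] {IM : ModelWithCorners ℝ EM HM} [TopologicalSpace M]
    [ChartedSpace HM M] (g : ContMDiffRiemannianMetric IB m F E) {b : M → B} {v w : ∀ x, E (b x)}
    {x : M} (hv : ContMDiffAt IM (IB.prod 𝓘(ℝ, F)) m (fun t => TotalSpace.mk' F (b t) (v t)) x)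
    (hw : ContMDiffAt IM (IB.prod 𝓘(ℝ, F)) m (fun t => TotalSpace.mk' F (b t) (w t)) x) :
    ContMDiffAt IM 𝓘(ℝ) m (fun t => g.inner (b t) (v t) (w t)) x := by
  have hb : ContMDiffAt IM IB m b x := (contMDiffAt_totalSpace.1 hv).1
  have htotal : ContMDiffAt IM (IB.prod 𝓘(ℝ)) m (fun t =>
      TotalSpace.mk' ℝ (E := Bundle.Trivial B ℝ) (b t) (g.inner (b t) (v t) (w t))) x :=
    (g.contMDiff.contMDiffAt.comp x hb).clm_bundle_apply₂ hv hw
  exact (contMDiffAt_totalSpace.1 htotal).2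

variable {n : ℕ}

/-- The derivative of the inverse of the chart around `p₀`; its columns are the coordinate
fields. -/
def frame (p₀ : Sph n) (z : Coord n) : Coord n →L[ℝ] Coord n :=
  mfderiv 𝓘(ℝ, Coord n) (𝓡 n) (extChartAt (𝓡 n) p₀).symm z

/-- The transition map from the chart around `p₀` to the chart around `q`. -/
def transition (p₀ q : Sph n) (z : Coord n) : Coord n :=
  extChartAt (𝓡 n) q ((extChartAt (𝓡 n) p₀).symm z)

/-- The value of the tensor field `T` at `p`, as a bilinear form on the model `ℝⁿ` of `T_p Sⁿ`. -/
def formAt (T : TensorField n) (p : Sph n) : Coord n →L[ℝ] Coord n →L[ℝ] ℝ :=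
  T p

variable {p₀ q : Sph n} {z : Coord n}

theorem inChart_eq_bilinearComp (T : TensorField n) (p₀ : Sph n) (z : Coord n) :
    inChart T p₀ z =
      (formAt T ((extChartAt (𝓡 n) p₀).symm z)).bilinearComp (frame p₀ z) (frame p₀ z) :=
  rfl

theorem contMDiffAt_chart_symm (hz : z ∈ (extChartAt (𝓡 n) p₀).target) (m : WithTop ℕ∞) :
    ContMDiffAt 𝓘(ℝ, Coord n) (𝓡 n) m (extChartAt (𝓡 n) p₀).symm z :=
  (contMDiffOn_extChartAt_symm p₀).contMDiffAt ((isOpen_extChartAt_target p₀).mem_nhds hz)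

theorem isInvertible_frame (hz : z ∈ (extChartAt (𝓡 n) p₀).target) :
    (frame p₀ z).IsInvertible := by
  have h := isInvertible_mfderivWithin_extChartAt_symm (I := 𝓡 n) hz
  rwa [modelWithCornersSelf_coe, Set.range_id, mfderivWithin_univ] at h

theorem contDiffAt_transition (hz : z ∈ (extChartAt (𝓡 n) p₀).target)
    (hq : (extChartAt (𝓡 n) p₀).symm z ∈ (extChartAt (𝓡 n) q).source) (m : WithTop ℕ∞) :
    ContDiffAt ℝ m (transition p₀ q) z :=
  contMDiffAt_iff_contDiffAt.1 <|
    (contMDiffAt_extChartAt' (by rwa [extChartAt_source] at hq)).comp z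
      (contMDiffAt_chart_symm hz m)

theorem eventually_mem_source (hz : z ∈ (extChartAt (𝓡 n) p₀).target)
    (hq : (extChartAt (𝓡 n) p₀).symm z ∈ (extChartAt (𝓡 n) q).source) :
    ∀ᶠ t in 𝓝 z, (extChartAt (𝓡 n) p₀).symm t ∈ (extChartAt (𝓡 n) q).source :=
  (contMDiffAt_chart_symm hz 1).continuousAt.eventually
    ((isOpen_extChartAt_source q).mem_nhds hq)

theorem frame_eq_comp_transition (hz : z ∈ (extChartAt (𝓡 n) p₀).target)
    (hq : (extChartAt (𝓡 n) p₀).symm z ∈ (extChartAt (𝓡 n) q).source) :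
    frame p₀ z = frame q (transition p₀ q z) ∘L fderiv ℝ (transition p₀ q) z := by
  have heq : (extChartAt (𝓡 n) p₀).symm =ᶠ[𝓝 z] (extChartAt (𝓡 n) q).symm ∘ transition p₀ q := by
    filter_upwards [eventually_mem_source hz hq] with t ht
    exact ((extChartAt (𝓡 n) q).left_inv ht).symm
  exact mfderiv_eq_comp_fderiv heq
    ((contMDiffAt_chart_symm ((extChartAt (𝓡 n) q).map_source hq) 1).mdifferentiableAt one_ne_zero)
    ((contDiffAt_transition hz hq 1).differentiableAt one_ne_zero)

theorem inChart_eq_transition (T : TensorField n) (hz : z ∈ (extChartAt (𝓡 n) p₀).target)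
    (hq : (extChartAt (𝓡 n) p₀).symm z ∈ (extChartAt (𝓡 n) q).source) (u v : Coord n) :
    inChart T p₀ z u v = inChart T q (transition p₀ q z) (fderiv ℝ (transition p₀ q) z u)
      (fderiv ℝ (transition p₀ q) z v) := by
  have hpoint : (extChartAt (𝓡 n) q).symm (transition p₀ q z) = (extChartAt (𝓡 n) p₀).symm z :=
    (extChartAt (𝓡 n) q).left_inv hq
  rw [inChart_eq_bilinearComp, inChart_eq_bilinearComp, hpoint, frame_eq_comp_transition hz hq]
  rfl

theorem contDiffOn_inChart (g : C2Metric n) (p₀ : Sph n) :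
    ContDiffOn ℝ 2 (inChart g.inner p₀) (extChartAt (𝓡 n) p₀).target := by
  refine contDiffOn_clm_apply.2 fun u => contDiffOn_clm_apply.2 fun v z hz => ?_
  have hframe (w : Coord n) := contMDiffAt_mfderiv_apply (m := 2) (contMDiffAt_chart_symm hz 3)
    (by norm_num) w
  exact (contMDiffAt_iff_contDiffAt.1
    (contMDiffAt_inner g (hframe u) (hframe v))).contDiffWithinAt

theorem inChart_extChartAt_self (T : TensorField n) (p : Sph n) :
    inChart T p (extChartAt (𝓡 n) p p) = formAt T p := by
  ext u v
  exact inChart_self T p u v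

theorem frame_extChartAt_self (p : Sph n) : frame p (extChartAt (𝓡 n) p p) = .id ℝ (Coord n) := by
  have h := mfderivWithin_range_extChartAt_symm (I := 𝓡 n) (x := p)
  rwa [modelWithCornersSelf_coe, Set.range_id, mfderivWithin_univ] at h

theorem isInnerProduct_formAt_metric (g : C2Metric n) (p : Sph n) :
    IsInnerProduct (formAt g.inner p) :=
  ⟨g.symm p, g.pos p⟩

theorem IsInnerProduct.inChart {T : TensorField n} (hz : z ∈ (extChartAt (𝓡 n) p₀).target)
    (hT : IsInnerProduct (formAt T ((extChartAt (𝓡 n) p₀).symm z))) :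
    IsInnerProduct (inChart T p₀ z) := by
  rw [inChart_eq_bilinearComp]
  refine ⟨fun u v => hT.symm _ _, fun u hu => hT.pos _ ?_⟩
  exact (map_ne_zero_iff _ (isInvertible_frame hz).injective).2 hu

theorem isMetricAt_inChart (g : C2Metric n) (hz : z ∈ (extChartAt (𝓡 n) p₀).target) :
    IsMetricAt (inChart g.inner p₀) z := by
  have htarget := (isOpen_extChartAt_target p₀).mem_nhds hz
  refine ⟨(contDiffOn_inChart g p₀).contDiffAt htarget, ?_⟩
  filter_upwards [htarget] with t ht using (isInnerProduct_formAt_metric g _).inChart ht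

theorem isPullbackAt_transition (g : C2Metric n) (hz : z ∈ (extChartAt (𝓡 n) p₀).target)
    (hq : (extChartAt (𝓡 n) p₀).symm z ∈ (extChartAt (𝓡 n) q).source) :
    IsPullbackAt (transition p₀ q) (inChart g.inner p₀) (inChart g.inner q) z := by
  refine ⟨contDiffAt_transition hz hq 3, isMetricAt_inChart g hz,
    isMetricAt_inChart g ((extChartAt (𝓡 n) q).map_source hq), ?_⟩
  filter_upwards [(isOpen_extChartAt_target p₀).mem_nhds hz, eventually_mem_source hz hq]
    with t ht htq using inChart_eq_transition g.inner ht htq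

theorem ricciForm_inChart (g : C2Metric n) (hz : z ∈ (extChartAt (𝓡 n) p₀).target) :
    ricciForm (inChart g.inner p₀) z =
      (ricciForm (inChart g.inner ((extChartAt (𝓡 n) p₀).symm z))
        (extChartAt (𝓡 n) ((extChartAt (𝓡 n) p₀).symm z)
          ((extChartAt (𝓡 n) p₀).symm z))).bilinearComp (frame p₀ z) (frame p₀ z) := by
  set q := (extChartAt (𝓡 n) p₀).symm z with hq
  have hpull := isPullbackAt_transition g hz (q := q) (mem_extChartAt_source q)
  have hframe : frame p₀ z = fderiv ℝ (transition p₀ q) z :=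
    (frame_eq_comp_transition hz (mem_extChartAt_source q)).trans <| by
      rw [transition, ← hq, frame_extChartAt_self, ContinuousLinearMap.id_comp]
  ext u v
  rw [hpull.source.ricciForm_apply, hpull.ricciLocal, ← hpull.target.ricciForm_apply, hframe]
  rfl

end Charts

/-! ### Smooth dependence of the solution on the data -/

section Implicit

universe u

theorem exists_implicit_solution {A E F : Type*} [NormedAddCommGroup A] [NormedSpace ℝ A]
    [CompleteSpace A] [NormedAddCommGroup E] [NormedSpace ℝ E] [FiniteDimensional ℝ E]
    [NormedAddCommGroup F] [NormedSpace ℝ F] [FiniteDimensional ℝ F]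
    (hdim : finrank ℝ E = finrank ℝ F) {Φ : A × E → F} {L : E → F} {a : A} {x : E}
    {m : WithTop ℕ∞} (hm : m ≠ 0) (hΦ : ContDiffAt ℝ m Φ (a, x))
    (hline : ∀ w, HasLineDerivAt ℝ (fun z => Φ (a, z)) (L w) x w) (hL : ∀ w, L w = 0 → w = 0) :
    ∃ Θ : A × F → E, ContDiffAt ℝ m Θ (a, Φ (a, x)) ∧ Θ (a, Φ (a, x)) = x ∧
      ∀ᶠ p in 𝓝 (a, Φ (a, x)), Φ (p.1, Θ p) = p.2 := by
  have := FiniteDimensional.complete ℝ E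
  have := FiniteDimensional.complete ℝ F
  let f : (A × F) × E → F := fun p => Φ (p.1.1, p.2) - p.1.2
  let p₀ : (A × F) × E := ((a, Φ (a, x)), x)
  have hf : ContDiffAt ℝ m f p₀ :=
    (hΦ.comp p₀ (contDiffAt_fst.fst.prodMk contDiffAt_snd)).sub contDiffAt_fst.snd
  have hpartial (w : E) : fderiv ℝ f p₀ (0, w) = L w := by
    have hw : HasLineDerivAt ℝ f (L w) p₀ (0, w) := by
      simpa [HasLineDerivAt, f, p₀] using (hline w).sub_const (Φ (a, x))
    exact ((hf.differentiableAt hm).hasFDerivAt.hasLineDerivAt (0, w)).unique hw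
  have hinv : (fderiv ℝ f p₀ ∘L .inr ℝ (A × F) E).IsInvertible :=
    isInvertible_of_injective hdim fun w hw => hL w ((hpartial w).symm.trans hw)
  refine ⟨hf.implicitFunction hm hinv, hf.contDiffAt_implicitFunction hm hinv,
    hf.implicitFunction_apply_self hm hinv, ?_⟩
  filter_upwards [hf.eventually_apply_implicitFunction hm hinv] with p hp
  exact sub_eq_zero.1 (hp.trans (sub_self _))

variable {D E : Type u} [NormedAddCommGroup D] [NormedSpace ℝ D] [NormedAddCommGroup E]
  [NormedSpace ℝ E] [FiniteDimensional ℝ E]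

theorem contDiffAt_gaussMap {p : (E →L[ℝ] E →L[ℝ] ℝ) × (E →L[ℝ] E →L[ℝ] ℝ)}
    (hG : p.1.IsInvertible) (m : WithTop ℕ∞) :
    ContDiffAt ℝ m (fun p : (E →L[ℝ] E →L[ℝ] ℝ) × (E →L[ℝ] E →L[ℝ] ℝ) => gaussMap p.1 p.2) p := by
  let trace : (E →L[ℝ] E) →L[ℝ] ℝ :=
    (LinearMap.trace ℝ E ∘ₗ ContinuousLinearMap.coeLM ℝ).toContinuousLinearMap
  have hshape : ContDiffAt ℝ m
      (fun p : (E →L[ℝ] E →L[ℝ] ℝ) × (E →L[ℝ] E →L[ℝ] ℝ) => p.1.inverse ∘L p.2) p :=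
    (hG.contDiffAt_map_inverse.comp p contDiffAt_fst).clm_comp contDiffAt_snd
  exact ((trace.contDiff.contDiffAt.comp p hshape).smul contDiffAt_snd).sub
    (contDiffAt_snd.clm_comp hshape)

theorem exists_contDiffAt_gaussMap_eq (h3 : 3 ≤ finrank ℝ E) {G X : E →L[ℝ] E →L[ℝ] ℝ}
    (hG : IsInnerProduct G) (hX : IsInnerProduct X) {m : WithTop ℕ∞} (hm : m ≠ 0) :
    ∃ Θ : (E →L[ℝ] E →L[ℝ] ℝ) × (E →L[ℝ] E →L[ℝ] ℝ) → E →L[ℝ] E →L[ℝ] ℝ,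
      ContDiffAt ℝ m Θ (G, gaussMap G X) ∧ Θ (G, gaussMap G X) = X ∧
      ∀ᶠ p in 𝓝 (G, gaussMap G X), gaussMap p.1 (Θ p) = p.2 :=
  exists_implicit_solution rfl hm (contDiffAt_gaussMap hG.isInvertible m)
    (hasLineDerivAt_gaussMap G X) fun _ => eq_zero_of_gaussLin_eq_zero h3 hG hX

theorem holderAt_of_gaussMap_eq (h3 : 3 ≤ finrank ℝ E) {k : ℕ} {α : ℝ≥0} (hα : α ≤ 1)
    {G R X : D → E →L[ℝ] E →L[ℝ] ℝ} {y : D} (hG : HolderAt k α G y) (hR : HolderAt k α R y)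
    (hGX : ∀ᶠ z in 𝓝 y,
      IsInnerProduct (G z) ∧ IsInnerProduct (X z) ∧ gaussMap (G z) (X z) = R z) :
    HolderAt k α X y := by
  obtain ⟨hGy, hXy, hRy⟩ := hGX.self_of_nhds
  obtain ⟨Θ, hΘ, hΘy, hΘR⟩ := exists_contDiffAt_gaussMap_eq h3 hGy hXy
    (m := (k + 1 : ℕ)) (by exact_mod_cast k.succ_ne_zero)
  rw [hRy] at hΘ hΘy hΘR
  have hGR := hG.prodMk hR
  have hΘGR : HolderAt k α (fun z => Θ (G z, R z)) y := hGR.contDiffAt_comp hα hΘ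
  have hpos := hΘGR.1.continuousAt.eventually (hΘy.symm ▸ hXy.eventually_pos)
  refine hΘGR.congr_of_eventuallyEq ?_
  filter_upwards [hGX, hGR.1.continuousAt.eventually hΘR, hpos]
    with z ⟨hGz, hXz, hXR⟩ hΘz hpos_z
  have hXflip : (X z).flip = X z := by
    ext u v
    exact hXz.symm v u
  have hRflip : (R z).flip = R z := by rw [← hXR, ← gaussMap_flip hGz, hXflip]
  have hΘinner : IsInnerProduct (Θ (G z, R z)) :=
    isInnerProduct_of_gaussMap_symm h3 hGz hpos_z fun u v => by
      rw [hΘz]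
      exact congr($hRflip v u)
  exact eq_of_gaussMap_eq h3 hGz (hXz.add hΘinner) (hXR.trans hΘz.symm)

end Implicit

/-! ### The once-contracted Gauss equation on the sphere -/

section Sphere

variable {n : ℕ}

theorem riemann_pos_of_hasPositiveSectionalCurvature {g : C2Metric n}
    (hg : HasPositiveSectionalCurvature g) (p : Sph n) {u v : Coord n}
    (huv : LinearIndependent ℝ ![u, v]) :
    0 < formAt g.inner p (riemann (inChart g.inner p) (extChartAt (𝓡 n) p p) u v v) u := by
  have hquot : 0 < formAt g.inner p
      (riemann (inChart g.inner p) (extChartAt (𝓡 n) p p) u v v) u /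
      (formAt g.inner p u u * formAt g.inner p v v - formAt g.inner p u v ^ 2) := hg p u v huv
  have hgram := (isInnerProduct_formAt_metric g p).sq_apply_le u v
  by_contra! hneg
  exact hquot.not_ge (div_nonpos_of_nonpos_of_nonneg hneg (sub_nonneg.2 hgram))

theorem isSolution_iff {g : C2Metric n} {χ : TensorField n} :
    IsSolution g χ ↔ ∀ p : Sph n, IsInnerProduct (formAt χ p) ∧
      gaussMap (formAt g.inner p) (formAt χ p) =
        ricciForm (inChart g.inner p) (extChartAt (𝓡 n) p p) := by
  have hgauss (p : Sph n) : gaussMap (formAt g.inner p) (formAt χ p) =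
      ricciForm (inChart g.inner p) (extChartAt (𝓡 n) p p) ↔ ∀ u v, ricci g p u v =
        metricTrace g χ p * χ p u v - χ p (shape g χ p u) v := by
    simp only [ContinuousLinearMap.ext_iff,
      (isMetricAt_inChart g (mem_extChartAt_target p)).ricciForm_apply]
    exact forall₂_congr fun u v => eq_comm
  simp only [hgauss]
  exact ⟨fun ⟨hsymm, hpos, heq⟩ p => ⟨⟨hsymm p, hpos p⟩, heq p⟩,
    fun h => ⟨fun p => (h p).1.symm, fun p => (h p).1.pos, fun p => (h p).2⟩⟩

theorem exists_isSolution (hn : 3 ≤ n) {g : C2Metric n} (hg : HasPositiveSectionalCurvature g) :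
    ∃ χ : TensorField n, IsSolution g χ := by
  have hpoint (p : Sph n) : ∃ X, IsInnerProduct X ∧ gaussMap (formAt g.inner p) X =
      ricciForm (inChart g.inner p) (extChartAt (𝓡 n) p p) := by
    have h := (isMetricAt_inChart g (mem_extChartAt_target p)).exists_gaussMap_eq_ricciForm hn
    rw [inChart_extChartAt_self] at h
    exact h fun u v => riemann_pos_of_hasPositiveSectionalCurvature hg p
  choose χ hχ using hpoint
  exact ⟨χ, isSolution_iff.2 hχ⟩

theorem IsSolution.unique (hn : 3 ≤ n) {g : C2Metric n} {χ χ' : TensorField n}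
    (h : IsSolution g χ) (h' : IsSolution g χ') : χ = χ' := by
  rw [isSolution_iff] at h h'
  exact funext fun p => eq_of_gaussMap_eq (by rwa [finrank_euclideanSpace_fin])
    (isInnerProduct_formAt_metric g p) ((h p).1.add (h' p).1) ((h p).2.trans (h' p).2.symm)

theorem IsSolution.gaussMap_inChart {g : C2Metric n} {χ : TensorField n} (h : IsSolution g χ)
    {p₀ : Sph n} {z : Coord n} (hz : z ∈ (extChartAt (𝓡 n) p₀).target) :
    gaussMap (inChart g.inner p₀ z) (inChart χ p₀ z) = ricciForm (inChart g.inner p₀) z := by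
  have hg := isInnerProduct_formAt_metric g ((extChartAt (𝓡 n) p₀).symm z)
  rw [ricciForm_inChart g hz, ← (isSolution_iff.1 h _).2]
  exact gaussMap_bilinearComp hg _ (isInvertible_frame hz) (hg.inChart hz)

theorem isHolderClass_iff {k : ℕ} {α : ℝ≥0} {T : TensorField n} :
    IsHolderClass k α T ↔
      ∀ p₀ : Sph n, ∀ z ∈ (extChartAt (𝓡 n) p₀).target, HolderAt k α (inChart T p₀) z := by
  refine ⟨fun h p₀ z hz => ⟨?_, (h p₀).2 z hz⟩,
    fun h p₀ => ⟨fun z hz => (h p₀ z hz).1.contDiffWithinAt, fun z hz => (h p₀ z hz).2⟩⟩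
  exact (h p₀).1.contDiffAt ((isOpen_extChartAt_target p₀).mem_nhds hz)

theorem IsSolution.isHolderClass (hn : 3 ≤ n) {g : C2Metric n} {χ : TensorField n}
    (h : IsSolution g χ) {k : ℕ} {α : ℝ≥0} (hα : α ≤ 1)
    (hg : IsHolderClass (k + 2) α g.inner) : IsHolderClass k α χ := by
  rw [isHolderClass_iff] at hg ⊢
  intro p₀ y hy
  have hG := hg p₀ y hy
  have hinner {z : Coord n} (hz : z ∈ (extChartAt (𝓡 n) p₀).target) :
      IsInnerProduct (inChart g.inner p₀ z) := (isInnerProduct_formAt_metric g _).inChart hz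
  refine holderAt_of_gaussMap_eq (by rwa [finrank_euclideanSpace_fin]) hα
    ((hG.of_succ hα).of_succ hα) (hG.ricciForm hα (hinner hy).isInvertible) ?_
  filter_upwards [(isOpen_extChartAt_target p₀).mem_nhds hy] with z hz
  exact ⟨hinner hz, (isSolution_iff.1 h _).1.inChart hz, h.gaussMap_inChart hz⟩

end Sphere

end SphereGauss

end

theorem theorem5p4_general (n : ℕ) (hn : 3 ≤ n) (g : SphereGauss.C2Metric n) :
    (SphereGauss.HasPositiveSectionalCurvature g →
      ∃ χ : SphereGauss.TensorField n, SphereGauss.IsSolution g χ) ∧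
    (∀ χ χ' : SphereGauss.TensorField n,
      SphereGauss.IsSolution g χ → SphereGauss.IsSolution g χ' → χ = χ') ∧
    ∀ χ : SphereGauss.TensorField n, SphereGauss.IsSolution g χ →
      ∀ (k : ℕ) (α : ℝ≥0), α ≤ 1 →
        SphereGauss.IsHolderClass (k + 2) α g.inner → SphereGauss.IsHolderClass k α χ :=
  ⟨SphereGauss.exists_isSolution hn, fun _ _ h h' => h.unique hn h',
    fun _ h _ _ hα hg => h.isHolderClass hn hα hg⟩

theorem theorem5p4 (n : ℕ) (hn : 3 ≤ n) (g : SphereGauss.C2Metric n)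
    (hg : SphereGauss.HasPositiveSectionalCurvature g) :
    (∃! χ : SphereGauss.TensorField n, SphereGauss.IsSolution g χ) ∧
    ∀ χ : SphereGauss.TensorField n, SphereGauss.IsSolution g χ →
      ∀ (k : ℕ) (α : ℝ≥0), 2 ≤ k → α < 1 →
        SphereGauss.IsHolderClass k α g.inner → SphereGauss.IsHolderClass (k - 2) α χ := by
  obtain ⟨hex, huniq, hreg⟩ := theorem5p4_general n hn g
  refine ⟨?_, fun χ hχ k α hk hα hgk => ?_⟩
  · obtain ⟨χ, hχ⟩ := hex hg
    exact ⟨χ, hχ, fun χ' hχ' => huniq χ' χ hχ' hχ⟩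
  · obtain ⟨m, rfl⟩ := Nat.exists_eq_add_of_le' hk
    exact hreg χ hχ m α hα.le hgk
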